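/- Let $q$ be a prime power and let $0\le a<1$ (with the convention $0^0=1$). For $n\ge 0$ let $U(n,q)\le GL(n,q^2)$ be the finite unitary group, i.e. the group of all invertible $n\times n$ matrices over $\mathbb F_{q^2}$ that preserve the Hermitian form $\langle x,y\rangle=\sum_{i=1}^n x_i y_i^{\,q}$ on $\mathbb F_{q^2}^n$ (for $n=0$ it is the trivial group acting on the zero space). For real $A,p$ with $|p|<1$ write $(A;p)_k=\prod_{i=0}^{k-1}(1-Ap^i)$ and $(A;p)_\infty=\prod_{i\ge 0}(1-Ap^i)$, and let $$w_k(a;p)=(ap;p)_\infty\,\frac{p^{k^2}a^k}{(p;p)_k\,(ap;p)_k},\qquad k=0,1,2,\dots,$$ be the Al-Salam–Carlitz weight. Choose a non-negative integer $n$ with probability $(1-a)a^n$, and then choose an element $g$ of $U(n,q)$ uniformly at random. Then for every $k\ge 0$ the probability that $g$ has exactly $q^{2k}$ fixed vectors in $\mathbb F_{q^2}^n$ equals the weight with $p=-1/q$ and $a$ replaced by $-a$: $$\sum_{n\ge 0}(1-a)a^n\,\frac{\#\{g\in U(n,q): g\text{ has exactly }q^{2k}\text{ fixed vectors}\}}{|U(n,q)|}=w_k(-a;-1/q).$$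 Moreover these weights form a probability distribution: $w_k(-a;-1/q)\ge 0$ for all $k$, and $\sum_{k\ge 0}w_k(-a;-1/q)=1$. -/

import Mathlib

open scoped ENNReal

noncomputable section

/-- The standard Hermitian form `∑ i, x i * (y i) ^ q` on `F ^ n`, where `F` is the field with
`q ^ 2` elements (so that `t ↦ t ^ q` is the nontrivial automorphism of `F` over its subfield
with `q` elements). -/
def hermitianForm (q : ℕ) {F : Type*} [Field F] {n : ℕ} (x y : Fin n → F) : F :=
  ∑ i, x i * (y i) ^ q

/-- The finite unitary group `U(n,q)`, viewed as a subgroup of `GL(n,q^2)`: the invertible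
matrices over the field `F` with `q ^ 2` elements that preserve the standard Hermitian form. -/
def finiteUnitaryGroup (q : ℕ) (F : Type*) [Field F] (n : ℕ) :
    Subgroup (Matrix.GeneralLinearGroup (Fin n) F) where
  carrier := {g | ∀ x y : Fin n → F,
    hermitianForm q ((g : Matrix (Fin n) (Fin n) F).mulVec x)
      ((g : Matrix (Fin n) (Fin n) F).mulVec y) = hermitianForm q x y}
  mul_mem' := by
    intro g h hg hh x y
    simp only [Units.val_mul, ← Matrix.mulVec_mulVec]
    rw [hg, hh]
  one_mem' := by
    intro x y
    simp
  inv_mem' := by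
    intro g hg x y
    have key : ∀ z : Fin n → F, (g : Matrix (Fin n) (Fin n) F).mulVec
        (((g⁻¹ : Matrix.GeneralLinearGroup (Fin n) F) : Matrix (Fin n) (Fin n) F).mulVec z)
          = z := by
      intro z
      rw [Matrix.mulVec_mulVec, ← Units.val_mul, mul_inv_cancel]
      simp
    have h := hg
      (((g⁻¹ : Matrix.GeneralLinearGroup (Fin n) F) : Matrix (Fin n) (Fin n) F).mulVec x)
      (((g⁻¹ : Matrix.GeneralLinearGroup (Fin n) F) : Matrix (Fin n) (Fin n) F).mulVec y)
    rw [key, key] at h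
    exact h.symm

/-- The number of vectors `v ∈ F ^ n` with `g v = v`. -/
def numFixedVectors {F : Type*} [Field F] {n : ℕ}
    (g : Matrix.GeneralLinearGroup (Fin n) F) : ℕ :=
  Nat.card {v : Fin n → F // (g : Matrix (Fin n) (Fin n) F).mulVec v = v}

/-- The probability distribution on the non-negative integers that gives mass `(1 - a) * a ^ n`
to `n`. -/
def geometricSizeLaw (a : ℝ) (ha0 : 0 ≤ a) (ha1 : a < 1) : PMF ℕ :=
  ⟨fun n => ENNReal.ofReal ((1 - a) * a ^ n), by
    have h : HasSum (fun n : ℕ => (1 - a) * a ^ n) 1 := by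
      have := (hasSum_geometric_of_lt_one ha0 ha1).mul_left (1 - a)
      rwa [mul_inv_cancel₀ (by linarith)] at this
    have h0 : ∀ n : ℕ, 0 ≤ (1 - a) * a ^ n := fun n =>
      mul_nonneg (by linarith) (pow_nonneg ha0 n)
    have h2 : ∑' n : ℕ, ENNReal.ofReal ((1 - a) * a ^ n) = 1 := by
      rw [← ENNReal.ofReal_tsum_of_nonneg h0 h.summable, h.tsum_eq, ENNReal.ofReal_one]
    rw [← h2]
    exact ENNReal.summable.hasSum⟩

/-- The uniform distribution on `U(n,q)`. -/
def uniformUnitary (q : ℕ) (F : Type*) [Field F] [Finite F] (n : ℕ) :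
    PMF (finiteUnitaryGroup q F n) :=
  letI := Fintype.ofFinite (finiteUnitaryGroup q F n)
  PMF.uniformOfFintype (finiteUnitaryGroup q F n)

/-- A random element of a random unitary group: first `n` is chosen with probability
`(1 - a) * a ^ n`, then an element of `U(n,q)` is chosen uniformly. -/
def randomUnitary (q : ℕ) (F : Type*) [Field F] [Finite F] (a : ℝ) (ha0 : 0 ≤ a) (ha1 : a < 1) :
    PMF (Σ n : ℕ, finiteUnitaryGroup q F n) :=
  (geometricSizeLaw a ha0 ha1).bind fun n => (uniformUnitary q F n).map (Sigma.mk n)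

/-- The distribution of the number of fixed vectors of a random element of a random unitary
group. -/
def fixedVectorsLaw (q : ℕ) (F : Type*) [Field F] [Finite F] (a : ℝ) (ha0 : 0 ≤ a) (ha1 : a < 1) :
    PMF ℕ :=
  (randomUnitary q F a ha0 ha1).map fun g => numFixedVectors g.2.1

/-- The finite shifted factorial `(A;p)_k = ∏_{0 ≤ i < k} (1 - A p^i)`. -/
def qShifted (A p : ℝ) (k : ℕ) : ℝ :=
  ∏ i ∈ Finset.range k, (1 - A * p ^ i)

/-- The infinite shifted factorial `(A;p)_∞ = ∏_{i ≥ 0} (1 - A p^i)`, for `|p| < 1`. -/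
def qShiftedInf (A p : ℝ) : ℝ :=
  ∏' i : ℕ, (1 - A * p ^ i)

/-- For `|p| < 1` the product that defines `(A;p)_∞` converges. -/
theorem multipliable_qShiftedInf (A p : ℝ) (hp : |p| < 1) :
    Multipliable fun i : ℕ => 1 - A * p ^ i := by
  have h : Summable fun i : ℕ => -(A * p ^ i) :=
    ((summable_geometric_of_abs_lt_one hp).mul_left A).neg
  simpa [sub_eq_add_neg] using Real.multipliable_one_add_of_summable h

/-- The Al-Salam–Carlitz weight
`(a p; p)_∞ * p ^ (k ^ 2) * a ^ k / ((p; p)_k * (a p; p)_k)`, `k = 0, 1, 2, …`. -/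
def alSalamCarlitzWeight (a p : ℝ) (k : ℕ) : ℝ :=
  qShiftedInf (a * p) p * (p ^ (k ^ 2) * a ^ k / (qShifted p p k * qShifted (a * p) p k))

end

/-! The fixed-vector probabilities and the weights satisfy the same first-order recursion in `k`,
and both sum to 1, so they agree.

The recursion comes from orbit counting. For a function `f` of the number `m` of fixed vectors,
average `(m - 1) * f m` over `U(n, q)`, sorting the nonzero fixed vectors by norm. Nonzero vectors
of one norm form a single orbit (`exists_isometry_apply_eq`), so each norm contributes an average of
`f` over a stabilizer. For each of the `q - 1` nonzero norms the stabilizer is `U(n - 1, q)`, with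
`m` multiplied by `q ^ 2`. For norm zero the stabilizer consists of an isometry `h` in dimension `n
- 2` together with a unipotent part `(u, c)`; the fixed vectors number `m`, `q ^ 2 * m` or `q ^ 4 *
m`, with `m` counted for `h`, according to whether `u` lies in the image of `h - 1` and whether a
trace-zero parameter vanishes (`uniformMean_hyperbolicMap`). The result is
`meanFixed_standardForm_add_two`.

Taking indicators for `f` and averaging geometrically over `n` removes the dimension and leaves a
three-term recursion in `k` (`geometricMean_fixedProb_succ`). With `p = -1/q` its leading
coefficient factors, and induction reduces it to the two-term relation of the weights
(`two_term_of_three_term`). The constant is fixed by total mass: the number of fixed vectors is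
always a power of `q ^ 2`, and the weights sum to 1 by Cauchy's identity (`tsum_cauchyTerm`). -/

/-! ### Trace and norm of a quadratic extension of finite fields. -/

/-- An involution `σ` of a field with `q ^ 2` elements, together with the standard facts about its
trace `t + σ t` and its norm `t * σ t`. -/
structure IsQuadraticConj (q : ℕ) {F : Type*} [Field F] (σ : F →+* F) : Prop where
  two_le : 2 ≤ q
  card : Nat.card F = q ^ 2
  invol : ∀ x, σ (σ x) = x
  card_fixed : Nat.card {c : F // σ c = c} = q
  exists_norm : ∀ c, σ c = c → ∃ t, t * σ t = c
  exists_trace : ∀ c, σ c = c → ∃ t, t + σ t = c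
  card_trace_zero : Nat.card {t : F // t + σ t = 0} = q

theorem Polynomial.card_root_subtype_le {F : Type*} [Field F] (p : Polynomial F) (hp : p ≠ 0) :
    Nat.card {t : F // p.eval t = 0} ≤ p.natDegree := by
  classical
  have h : {t : F | p.eval t = 0} = (p.roots.toFinset : Set F) := by
    ext t; simp [hp]
  calc Nat.card {t : F // p.eval t = 0} = Set.ncard {t : F | p.eval t = 0} := rfl
    _ = p.roots.toFinset.card := by rw [h, Set.ncard_coe_finset]
    _ ≤ Multiset.card p.roots := Multiset.toFinset_card_le _
    _ ≤ p.natDegree := p.card_roots'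

/-- Applied with `b = -1` to the kernel of the trace and with `b = 1` to the fixed field. -/
theorem card_pow_eq_mul_le {F : Type*} [Field F] (q : ℕ) (hq : 2 ≤ q) (b : F) :
    Nat.card {t : F // t ^ q = b * t} ≤ q := by
  have hdeg : (Polynomial.X ^ q - Polynomial.C b * Polynomial.X : Polynomial F).natDegree = q := by
    rw [Polynomial.natDegree_sub_eq_left_of_natDegree_lt, Polynomial.natDegree_X_pow]
    rw [Polynomial.natDegree_X_pow]
    exact lt_of_le_of_lt ((Polynomial.natDegree_C_mul_le b _).trans Polynomial.natDegree_X_le) (by omega)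
  have hne : (Polynomial.X ^ q - Polynomial.C b * Polynomial.X : Polynomial F) ≠ 0 := by
    intro h; rw [h] at hdeg; simp at hdeg; omega
  have := Polynomial.card_root_subtype_le _ hne
  rw [hdeg] at this
  simpa [sub_eq_zero] using this

theorem card_pow_eq_one_le {F : Type*} [Field F] [Finite F] (m : ℕ) (hm : 0 < m) :
    Nat.card {t : Fˣ // t ^ m = 1} ≤ m := by
  classical
  have hdeg : (Polynomial.X ^ m - Polynomial.C 1 : Polynomial F).natDegree = m :=
    Polynomial.natDegree_X_pow_sub_C
  have hne : (Polynomial.X ^ m - Polynomial.C 1 : Polynomial F) ≠ 0 :=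
    Polynomial.X_pow_sub_C_ne_zero hm 1
  have h := Polynomial.card_root_subtype_le _ hne
  rw [hdeg] at h
  refine le_trans (Nat.card_le_card_of_injective
    (fun t : {t : Fˣ // t ^ m = 1} =>
      (⟨(t.1 : F), by
        have := congrArg Units.val t.2
        simp only [Units.val_pow_eq_pow_val, Units.val_one] at this
        simp [this]⟩ :
        {t : F // (Polynomial.X ^ m - Polynomial.C 1 : Polynomial F).eval t = 0})) ?_) h
  intro s t hst
  simpa [Subtype.ext_iff, Units.ext_iff] using hst

/-- The map `t ↦ t ^ q` of a field with `q ^ 2` elements. -/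
theorem exists_isQuadraticConj {q : ℕ} (hq : IsPrimePow q) {F : Type*} [Field F] [Finite F]
    (hF : Nat.card F = q ^ 2) :
    ∃ σ : F →+* F, (∀ x, σ x = x ^ q) ∧ IsQuadraticConj q σ := by
  classical
  let _ := Fintype.ofFinite F
  have hq2 : 2 ≤ q := hq.two_le
  obtain ⟨p, m, hp, hm, rfl⟩ := (isPrimePow_nat_iff _).1 hq
  obtain ⟨r, hr, n, hrp, hcard⟩ := FiniteField.card' F
  have hrp' : r = p := by
    rw [Nat.card_eq_fintype_card, hcard] at hF
    have : r ∣ (p ^ m) ^ 2 := by rw [← hF]; exact dvd_pow_self r n.ne_zero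
    exact (Nat.prime_dvd_prime_iff_eq hrp hp).1
      (hrp.dvd_of_dvd_pow (hrp.dvd_of_dvd_pow this))
  subst hrp'
  have : ExpChar F r := ExpChar.prime hrp
  set q := r ^ m with hqdef
  let σ := iterateFrobenius F r m
  have hσ : ∀ x, σ x = x ^ q := fun x => iterateFrobenius_def ..
  have hinv : ∀ x, σ (σ x) = x := fun x => by
    rw [hσ, hσ, ← pow_mul, ← sq, ← hF, Nat.card_eq_fintype_card, FiniteField.pow_card]
  let T : F →+ F := AddMonoidHom.id F + σ.toAddMonoidHom
  have hT : ∀ x, T x = x + σ x := fun x => rfl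
  have hker : Nat.card T.ker ≤ q := by
    refine le_trans (le_of_eq ?_) (card_pow_eq_mul_le (F := F) q hq2 (-1))
    refine Nat.card_congr (Equiv.subtypeEquivRight fun t => ?_)
    rw [AddMonoidHom.mem_ker, hT, hσ, neg_one_mul, add_comm, add_eq_zero_iff_eq_neg]
  have hfix : Nat.card {c : F // σ c = c} ≤ q := by
    refine le_trans (le_of_eq ?_) (card_pow_eq_mul_le (F := F) q hq2 1)
    refine Nat.card_congr (Equiv.subtypeEquivRight fun t => ?_)
    rw [hσ, one_mul]
  have hsub : (T.range : Set F) ⊆ {c : F | σ c = c} := by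
    rintro _ ⟨x, rfl⟩
    simp only [Set.mem_ofPred_eq, hT, map_add, hinv, add_comm]
  have hrange : Nat.card T.range ≤ Nat.card {c : F // σ c = c} :=
    Set.ncard_le_ncard hsub (Set.toFinite _)
  have hmul : Nat.card T.ker * Nat.card T.range = q ^ 2 := by
    rw [← AddSubgroup.index_ker, AddSubgroup.card_mul_index, hF]
  -- Kernel and image of the trace have at most `q` elements each, and the product of their orders
  -- is `q ^ 2`, so both bounds are attained.
  have hk : Nat.card T.ker = q := by
    by_contra hne
    have : Nat.card T.ker < q := lt_of_le_of_ne hker hne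
    nlinarith
  have hr' : Nat.card T.range = q := by
    rw [hk, sq] at hmul; exact Nat.eq_of_mul_eq_mul_left (by omega) hmul
  have hfixq : Nat.card {c : F // σ c = c} = q := le_antisymm hfix (hr' ▸ hrange)
  have hrangeeq : (T.range : Set F) = {c : F | σ c = c} :=
    Set.eq_of_subset_of_ncard_le hsub (by
      change Nat.card {c : F // σ c = c} ≤ Nat.card T.range
      rw [hr', hfixq]) (Set.toFinite _)
  refine ⟨σ, hσ, hq2, hF, hinv, hfixq, ?_, ?_, ?_⟩
  · intro c hc
    by_cases hc0 : c = 0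
    · exact ⟨0, by simp [hc0]⟩
    -- The same squeeze for the norm `t ^ (q + 1)`: its kernel has at most `q + 1` elements, so its
    -- image has at least `q - 1`, and the image lies in the roots of `c ^ (q - 1) = 1`, of which
    -- there are at most `q - 1`.
    let N : Fˣ →* Fˣ := powMonoidHom (q + 1)
    have hkerN : Nat.card N.ker ≤ q + 1 :=
      card_pow_eq_one_le (F := F) (q + 1) (Nat.succ_pos q)
    have hunits : Nat.card Fˣ = (q + 1) * (q - 1) := by
      rw [Nat.card_units, hF, ← Nat.sq_sub_sq, one_pow]
    have hmulN : Nat.card N.ker * Nat.card N.range = (q + 1) * (q - 1) := by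
      rw [← Subgroup.index_ker, Subgroup.card_mul_index, hunits]
    have hrN : q - 1 ≤ Nat.card N.range := by
      refine le_of_mul_le_mul_left ?_ (Nat.succ_pos q)
      change (q + 1) * _ ≤ (q + 1) * _
      rw [← hmulN]; exact Nat.mul_le_mul_right _ hkerN
    have hsubN : (N.range : Set Fˣ) ⊆ {c : Fˣ | c ^ (q - 1) = 1} := by
      rintro _ ⟨x, rfl⟩
      simp only [N, powMonoidHom_apply, Set.mem_ofPred_eq, ← pow_mul]
      rw [← hunits, pow_card_eq_one']
    have hrangeN : (N.range : Set Fˣ) = {c : Fˣ | c ^ (q - 1) = 1} :=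
      Set.eq_of_subset_of_ncard_le hsubN (by
        change Nat.card {c : Fˣ // c ^ (q - 1) = 1} ≤ Nat.card N.range
        exact (card_pow_eq_one_le _ (by omega)).trans hrN) (Set.toFinite _)
    have hcm : Units.mk0 c hc0 ∈ (N.range : Set Fˣ) := by
      rw [hrangeN]
      refine Units.ext ?_
      have h1 : c ^ (q - 1) * c = 1 * c := by
        rw [← pow_succ, Nat.sub_add_cancel (by omega), ← hσ, hc, one_mul]
      simpa using mul_right_cancel₀ hc0 h1
    obtain ⟨t, ht⟩ := hcm
    refine ⟨t, ?_⟩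
    have := congrArg Units.val ht
    simp only [N, powMonoidHom_apply, Units.val_pow_eq_pow_val, Units.val_mk0] at this
    rw [hσ, ← this, pow_succ']
  · intro c hc
    have : c ∈ (T.range : Set F) := by rw [hrangeeq]; exact hc
    exact this
  · exact hk

/-! ### Hermitian spaces and transitivity on vectors of equal norm. -/

/-- A nondegenerate Hermitian form, linear in its first argument, with respect to `σ`. -/
structure IsHermitianForm {F : Type*} [Field F] (σ : F →+* F) {V : Type*} [AddCommGroup V]
    [Module F V] (B : V → V → F) : Prop where
  add_left : ∀ x y z, B (x + y) z = B x z + B y z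
  smul_left : ∀ (c : F) x z, B (c • x) z = c * B x z
  symm : ∀ x y, σ (B x y) = B y x
  nondeg : ∀ x, (∀ y, B x y = 0) → x = 0

/-- The group of linear automorphisms that preserve a form. -/
def isometryGroup (F : Type*) [Field F] {V : Type*} [AddCommGroup V] [Module F V]
    (B : V → V → F) : Subgroup (V ≃ₗ[F] V) where
  carrier := {g | ∀ x y, B (g x) (g y) = B x y}
  mul_mem' := fun {g h} hg hh x y => by
    rw [LinearEquiv.mul_apply, LinearEquiv.mul_apply, hg, hh]
  one_mem' := fun _ _ => rfl
  inv_mem' := fun {g} hg x y => by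
    have h := hg (g⁻¹ x) (g⁻¹ y)
    rw [← LinearEquiv.mul_apply, ← LinearEquiv.mul_apply, mul_inv_cancel] at h
    exact h.symm

section HermitianForm

variable {F : Type*} [Field F] {σ : F →+* F} {V : Type*} [AddCommGroup V] [Module F V]
  {B : V → V → F}

namespace IsHermitianForm

theorem zero_left (hB : IsHermitianForm σ B) (z : V) : B 0 z = 0 := by
  simpa using hB.smul_left 0 0 z

theorem neg_left (hB : IsHermitianForm σ B) (x z : V) : B (-x) z = -B x z := by
  simpa using hB.smul_left (-1) x z

theorem sub_left (hB : IsHermitianForm σ B) (x y z : V) : B (x - y) z = B x z - B y z := by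
  rw [sub_eq_add_neg, hB.add_left, hB.neg_left, sub_eq_add_neg]

theorem add_right (hB : IsHermitianForm σ B) (x y z : V) : B x (y + z) = B x y + B x z := by
  rw [← hB.symm, hB.add_left, map_add, hB.symm, hB.symm]

theorem smul_right (hB : IsHermitianForm σ B) (c : F) (x z : V) : B x (c • z) = σ c * B x z := by
  rw [← hB.symm, hB.smul_left, map_mul, hB.symm]

theorem zero_right (hB : IsHermitianForm σ B) (z : V) : B z 0 = 0 := by
  rw [← hB.symm, hB.zero_left, map_zero]

theorem neg_right (hB : IsHermitianForm σ B) (x z : V) : B x (-z) = -B x z := by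
  rw [← hB.symm, hB.neg_left, map_neg, hB.symm]

theorem sub_right (hB : IsHermitianForm σ B) (x y z : V) : B x (y - z) = B x y - B x z := by
  rw [sub_eq_add_neg, hB.add_right, hB.neg_right, sub_eq_add_neg]

theorem nondeg_right (hB : IsHermitianForm σ B) (x : V) (h : ∀ y, B y x = 0) : x = 0 :=
  hB.nondeg x fun y => by rw [← hB.symm, h, map_zero]

theorem injective_of_preserves (hB : IsHermitianForm σ B) {W : Type*} [AddCommGroup W]
    [Module F W] {B' : W → W → F} (hB' : IsHermitianForm σ B') (T : V →ₗ[F] W)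
    (hT : ∀ x y, B' (T x) (T y) = B x y) : Function.Injective T := by
  rw [injective_iff_map_eq_zero]
  intro x hx
  refine hB.nondeg x fun y => ?_
  rw [← hT, hx, hB'.zero_left]

/-- A linear endomorphism preserving a Hermitian form of a finite space is an isometry. -/
theorem exists_isometry (hB : IsHermitianForm σ B) [Finite V] (T : V →ₗ[F] V)
    (hT : ∀ x y, B (T x) (T y) = B x y) : ∃ g : isometryGroup F B, ∀ x, g.1 x = T x :=
  ⟨⟨LinearEquiv.ofBijective T
    (Finite.injective_iff_bijective.1 (hB.injective_of_preserves hB T hT)), hT⟩, fun _ => rfl⟩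

/-- The quasi-reflection that moves `x` to `y`. -/
theorem exists_isometry_of_ne_zero (hB : IsHermitianForm σ B) [Finite V] {x y : V}
    (hxy : B x x = B y y) (hne : B x (x - y) ≠ 0) : ∃ g : isometryGroup F B, g.1 x = y := by
  set u := x - y with hu
  -- This `β` makes `v ↦ v - β B(v,u) u` send `x` to `x - u = y`. Preserving `B` requires `β σ(β)
  -- B(u,u) = β + σ(β)`, which follows from `huu`, that is, `B(u,u) = 1/β + 1/σ(β)`.
  set β := (B x u)⁻¹ with hβ
  have hβ1 : β * B x u = 1 := inv_mul_cancel₀ hne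
  have hβ2 : σ β * B u x = 1 := by rw [← hB.symm, ← map_mul, hβ1, map_one]
  have huu : B u u = B x u + B u x := by
    simp only [hu, hB.sub_left, hB.sub_right, hxy]; ring
  clear_value u β
  let T : V →ₗ[F] V :=
    { toFun := fun v => v - (β * B v u) • u
      map_add' := fun v w => by
        rw [hB.add_left, mul_add, add_smul]; abel
      map_smul' := fun c v => by
        rw [hB.smul_left, RingHom.id_apply, smul_sub, smul_smul]; congr 2; ring }
  have hTv : ∀ v, T v = v - (β * B v u) • u := fun _ => rfl
  obtain ⟨g, hg⟩ := hB.exists_isometry T fun v w => by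
    simp only [hTv, hB.sub_left, hB.sub_right, hB.smul_left, hB.smul_right, map_mul, hB.symm, huu]
    linear_combination (σ β * B u w * B v u) * hβ1 + (β * B v u * B u w) * hβ2
  refine ⟨g, ?_⟩
  rw [hg, hTv, hβ1, one_smul, hu, sub_sub_cancel]

/-- Nonzero vectors of the same norm are related by an isometry. -/
theorem exists_isometry_apply_eq (hB : IsHermitianForm σ B) [Finite F] [Finite V] {q : ℕ}
    (hσ : IsQuadraticConj q σ) {x y : V} (hx : x ≠ 0) (hy : y ≠ 0) (hxy : B x x = B y y) :
    ∃ g : isometryGroup F B, g.1 x = y := by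
  by_cases hne : B x (x - y) = 0
  swap
  · exact hB.exists_isometry_of_ne_zero hxy hne
  -- When the direct quasi-reflection degenerates, pass through a third vector `x + l • z` of the
  -- same norm. Taking `z` orthogonal to neither `x` nor `y` makes both intermediate
  -- quasi-reflections available.
  obtain ⟨z, hxz, hyz⟩ : ∃ z, B x z ≠ 0 ∧ B y z ≠ 0 := by
    obtain ⟨z₁, h₁⟩ : ∃ z, B x z ≠ 0 := by
      by_contra! h; exact hx (hB.nondeg x h)
    obtain ⟨z₂, h₂⟩ : ∃ z, B y z ≠ 0 := by
      by_contra! h; exact hy (hB.nondeg y h)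
    by_cases h₃ : B y z₁ = 0
    · by_cases h₄ : B x z₂ = 0
      · exact ⟨z₁ + z₂, by simpa [hB.add_right, h₄] using h₁, by simpa [hB.add_right, h₃] using h₂⟩
      · exact ⟨z₂, h₄, h₂⟩
    · exact ⟨z₁, h₁, h₃⟩
  obtain ⟨μ, hμ0, hμ⟩ : ∃ μ, μ ≠ 0 ∧ μ + σ μ = -B z z := by
    by_cases hz : B z z = 0
    · have hlt : 1 < Nat.card {t : F // t + σ t = 0} := by
        rw [hσ.card_trace_zero]; exact hσ.two_le
      have : Nontrivial {t : F // t + σ t = 0} := (Finite.one_lt_card_iff_nontrivial).1 hlt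
      obtain ⟨μ, hμ⟩ := exists_ne (⟨0, by simp⟩ : {t : F // t + σ t = 0})
      exact ⟨μ.1, fun h => hμ (Subtype.ext h), by rw [μ.2, hz, neg_zero]⟩
    · obtain ⟨μ, hμ⟩ := hσ.exists_trace (-B z z) (by rw [map_neg, hB.symm])
      refine ⟨μ, ?_, hμ⟩
      rintro rfl
      simp at hμ
      exact hz hμ
  -- With this `l` the norm of `x + l • z` exceeds that of `x` by `l σ(l) (μ + σ(μ) + B(z,z))`,
  -- which is zero by the choice of `μ`.
  set l := B x z / μ with hl
  have hl0 : l ≠ 0 := div_ne_zero hxz hμ0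
  have hσl0 : σ l ≠ 0 := (map_ne_zero σ).2 hl0
  have hl1 : l * μ = B x z := div_mul_cancel₀ _ hμ0
  have hl2 : σ l * σ μ = B z x := by rw [← map_mul, hl1, hB.symm]
  have hw : B x x = B (x + l • z) (x + l • z) := by
    simp only [hB.add_left, hB.add_right, hB.smul_left, hB.smul_right, ← hl1, ← hl2]
    linear_combination (-(l * σ l)) * hμ
  obtain ⟨g, hg⟩ := hB.exists_isometry_of_ne_zero hw (by
    rw [sub_add_cancel_left, hB.neg_right, hB.smul_right]
    exact neg_ne_zero.2 (mul_ne_zero hσl0 hxz))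
  have hyx : B y x = B x x := by
    have h1 : B x y = B x x := by
      rw [hB.sub_right, sub_eq_zero] at hne; exact hne.symm
    rw [← hB.symm, h1, hB.symm]
  obtain ⟨k, hk⟩ := hB.exists_isometry_of_ne_zero (hxy.symm.trans hw) (by
    rw [← sub_sub, hB.sub_right, hB.sub_right, hyx, hxy, sub_self, zero_sub, hB.smul_right]
    exact neg_ne_zero.2 (mul_ne_zero hσl0 hyz))
  refine ⟨k⁻¹ * g, ?_⟩
  change k.1.symm (g.1 x) = y
  rw [hg, ← hk, LinearEquiv.symm_apply_apply]

end IsHermitianForm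

end HermitianForm

/-! ### Uniform means and weighted orbit counting. -/

section UniformMean

/-- The mean of a real function on a finite type. -/
noncomputable def uniformMean {X : Type*} (φ : X → ℝ) : ℝ :=
  (∑ᶠ x, φ x) / Nat.card X

theorem uniformMean_eq_sum {X : Type*} [Fintype X] (φ : X → ℝ) :
    uniformMean φ = (∑ x, φ x) / Nat.card X := by
  rw [uniformMean, finsum_eq_sum_of_fintype]

theorem uniformMean_of_bijective {X Y : Type*} {φ : X → ℝ} {ψ : Y → ℝ} (e : X → Y)
    (he : Function.Bijective e) (h : ∀ x, φ x = ψ (e x)) : uniformMean φ = uniformMean ψ := by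
  rw [uniformMean, uniformMean, finsum_eq_of_bijective e he h, Nat.card_eq_of_bijective e he]

theorem uniformMean_add {X : Type*} [Finite X] (φ ψ : X → ℝ) :
    uniformMean (fun x => φ x + ψ x) = uniformMean φ + uniformMean ψ := by
  have := Fintype.ofFinite X
  simp only [uniformMean_eq_sum, Finset.sum_add_distrib, add_div]

theorem uniformMean_const_mul {X : Type*} [Finite X] (c : ℝ) (φ : X → ℝ) :
    uniformMean (fun x => c * φ x) = c * uniformMean φ := by
  have := Fintype.ofFinite X
  simp only [uniformMean_eq_sum, ← Finset.mul_sum, mul_div_assoc]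

theorem uniformMean_sum {X I : Type*} [Finite X] (s : Finset I) (φ : I → X → ℝ) :
    uniformMean (fun x => ∑ i ∈ s, φ i x) = ∑ i ∈ s, uniformMean (φ i) := by
  have := Fintype.ofFinite X
  simp only [uniformMean_eq_sum, Finset.sum_div]
  exact Finset.sum_comm

theorem uniformMean_prod {X Y : Type*} [Finite X] [Finite Y] (φ : X × Y → ℝ) :
    uniformMean φ = uniformMean fun x => uniformMean fun y => φ (x, y) := by
  have := Fintype.ofFinite X
  have := Fintype.ofFinite Y
  simp only [uniformMean_eq_sum, Fintype.sum_prod_type, Nat.card_prod, Nat.cast_mul,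
    ← Finset.sum_div, div_div]
  rw [mul_comm]

theorem uniformMean_nonneg {X : Type*} {φ : X → ℝ} (h : ∀ x, 0 ≤ φ x) : 0 ≤ uniformMean φ :=
  div_nonneg (finsum_nonneg h) (Nat.cast_nonneg _)

end UniformMean

/-- Orbit counting, weighted by a class function. -/
theorem uniformMean_card_fixed_mul {G Ω : Type*} [Group G] [MulAction G Ω] [Finite G] [Finite Ω]
    (P : Ω → Prop) (ω₀ : Ω) (hP : ∀ ω, P ω ↔ ∃ g : G, g • ω₀ = ω) (φ : G → ℝ)
    (hφ : ∀ g h : G, φ (h * g * h⁻¹) = φ g) :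
    uniformMean (fun g : G => (Nat.card {ω // P ω ∧ g • ω = ω} : ℝ) * φ g) =
      uniformMean fun g : MulAction.stabilizer G ω₀ => φ g.1 := by
  classical
  have := Fintype.ofFinite G
  have := Fintype.ofFinite Ω
  -- Points of the orbit have conjugate stabilizers, and `φ` is a class function, so every point
  -- contributes equally.
  have hstab : ∀ ω, P ω → (∑ g : G, if g • ω = ω then φ g else 0) =
      ∑ g : G, if g • ω₀ = ω₀ then φ g else 0 := by
    intro ω hω
    obtain ⟨h, rfl⟩ := (hP ω).1 hω
    refine (Fintype.sum_equiv (MulAut.conj h).toEquiv _ _ fun g => ?_).symm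
    simp only [MulEquiv.toEquiv_eq_coe, MulEquiv.coe_toEquiv, MulAut.conj_apply, hφ, mul_smul,
      inv_smul_smul, smul_left_cancel_iff]
  have hsub : (∑ g : MulAction.stabilizer G ω₀, φ g.1) =
      ∑ g : G, if g • ω₀ = ω₀ then φ g else 0 := by
    rw [← Finset.sum_filter]
    exact (Finset.sum_subtype _ (fun g => by simp [MulAction.mem_stabilizer_iff]) φ).symm
  have hleft : (∑ g : G, (Nat.card {ω // P ω ∧ g • ω = ω} : ℝ) * φ g) =
      Nat.card {ω // P ω} * ∑ g : G, if g • ω₀ = ω₀ then φ g else 0 := by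
    have h1 : ∀ g : G, (Nat.card {ω // P ω ∧ g • ω = ω} : ℝ) * φ g =
        ∑ ω : Ω, if P ω then (if g • ω = ω then φ g else 0) else 0 := by
      intro g
      rw [Nat.card_eq_fintype_card, Fintype.card_subtype, ← nsmul_eq_mul, ← Finset.sum_const,
        Finset.sum_filter]
      exact Finset.sum_congr rfl fun ω _ => by rw [ite_and]
    rw [Finset.sum_congr rfl fun g _ => h1 g, Finset.sum_comm, Nat.card_eq_fintype_card,
      Fintype.card_subtype, ← nsmul_eq_mul, ← Finset.sum_const, Finset.sum_filter]
    refine Finset.sum_congr rfl fun ω _ => ?_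
    by_cases hω : P ω
    · simp only [hω, if_true, hstab ω hω]
    · simp [hω]
  have hcard : Nat.card {ω // P ω} * Nat.card (MulAction.stabilizer G ω₀) = Nat.card G := by
    have : Nat.card {ω // P ω} = Nat.card (MulAction.orbit G ω₀) :=
      Nat.card_congr (Equiv.subtypeEquivRight fun ω => by
        rw [hP, MulAction.mem_orbit_iff])
    rw [this, Nat.card_eq_fintype_card, Nat.card_eq_fintype_card, Nat.card_eq_fintype_card,
      MulAction.card_orbit_mul_card_stabilizer_eq_card_group]
  have h0 : (Nat.card (MulAction.stabilizer G ω₀) : ℝ) ≠ 0 := by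
    exact_mod_cast Nat.card_pos.ne'
  have h1 : (Nat.card G : ℝ) ≠ 0 := by
    exact_mod_cast Nat.card_pos.ne'
  rw [uniformMean_eq_sum, uniformMean_eq_sum, hleft, hsub, div_eq_div_iff h1 h0, ← hcard]
  push_cast
  ring

/-! ### Fixed vectors averaged over isometry groups. -/

section MeanFixed

variable {F : Type*} [Field F] {V : Type*} [AddCommGroup V] [Module F V]

/-- The number of fixed vectors of a linear automorphism. -/
noncomputable def fixedCard (g : V ≃ₗ[F] V) : ℕ :=
  Nat.card {v // g v = v}

/-- The mean of a function of the number of fixed vectors over the isometry group of a form. -/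
noncomputable def meanFixed (F : Type*) [Field F] {V : Type*} [AddCommGroup V] [Module F V]
    (B : V → V → F) (f : ℕ → ℝ) : ℝ :=
  uniformMean fun g : isometryGroup F B => f (fixedCard g.1)

instance linearEquiv_finite [Finite V] : Finite (V ≃ₗ[F] V) :=
  DFunLike.finite _

theorem fixedCard_conj {W : Type*} [AddCommGroup W] [Module F W] (e : V ≃ₗ[F] W)
    (g : V ≃ₗ[F] V) (g' : W ≃ₗ[F] W) (h : ∀ x, g' (e x) = e (g x)) :
    fixedCard g' = fixedCard g :=
  (Nat.card_congr (e.toEquiv.subtypeEquiv fun v => by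
    simp [h])).symm

theorem fixedCard_mul_conj (g h : V ≃ₗ[F] V) : fixedCard (h * g * h⁻¹) = fixedCard g :=
  fixedCard_conj h g _ fun x => by
    change h (g (h.symm (h x))) = _
    rw [LinearEquiv.symm_apply_apply]

/-- An isometry of two spaces identifies means over their isometry groups. -/
theorem uniformMean_isometryGroup_congr {W : Type*} [AddCommGroup W] [Module F W] {B : V → V → F}
    {B' : W → W → F} (e : V ≃ₗ[F] W) (he : ∀ x y, B' (e x) (e y) = B x y)
    {φ : isometryGroup F B → ℝ} {ψ : isometryGroup F B' → ℝ}
    (h : ∀ g g', (∀ x, g'.1 (e x) = e (g.1 x)) → φ g = ψ g') :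
    uniformMean φ = uniformMean ψ := by
  have he' : ∀ x y, B (e.symm x) (e.symm y) = B' x y := fun x y => by
    rw [← he, e.apply_symm_apply, e.apply_symm_apply]
  refine uniformMean_of_bijective
    (fun g : isometryGroup F B => (⟨(e.symm.trans g.1).trans e, fun x y => by
      simp only [LinearEquiv.trans_apply, he, g.2 _ _, he']⟩ : isometryGroup F B')) ⟨?_, ?_⟩ ?_
  · intro g h hgh
    refine Subtype.ext (LinearEquiv.ext fun x => ?_)
    have := congrArg (fun k : isometryGroup F B' => k.1 (e x)) hgh
    simpa using this
  · intro g
    refine ⟨⟨(e.trans g.1).trans e.symm, fun x y => by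
      simp only [LinearEquiv.trans_apply, he', g.2 _ _, he]⟩, ?_⟩
    refine Subtype.ext (LinearEquiv.ext fun x => ?_)
    simp
  · intro g
    exact h _ _ fun x => by simp

theorem meanFixed_congr {W : Type*} [AddCommGroup W] [Module F W] {B : V → V → F} {B' : W → W → F}
    (e : V ≃ₗ[F] W) (he : ∀ x y, B' (e x) (e y) = B x y) (f : ℕ → ℝ) :
    meanFixed F B f = meanFixed F B' f :=
  uniformMean_isometryGroup_congr e he fun g g' h => by
    rw [fixedCard_conj e g.1 g'.1 h]

variable {σ : F →+* F} {B : V → V → F}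

/-- Orbit counting for the nonzero vectors of a given norm, with an explicit parametrization of the
stabilizer. -/
theorem IsHermitianForm.uniformMean_card_fixed_mul (hB : IsHermitianForm σ B) [Finite F] [Finite V]
    {q : ℕ} (hσ : IsQuadraticConj q σ) {v₀ : V} (hv₀ : v₀ ≠ 0) (f : ℕ → ℝ)
    {A : Type*} (Φ : A → isometryGroup F B) (hinj : Function.Injective Φ)
    (hfix : ∀ a, (Φ a).1 v₀ = v₀) (hsurj : ∀ g : isometryGroup F B, g.1 v₀ = v₀ → ∃ a, Φ a = g) :
    uniformMean (fun g : isometryGroup F B =>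
        (Nat.card {v // (v ≠ 0 ∧ B v v = B v₀ v₀) ∧ g.1 v = v} : ℝ) * f (fixedCard g.1)) =
      uniformMean fun a => f (fixedCard (Φ a).1) := by
  have h := _root_.uniformMean_card_fixed_mul (G := isometryGroup F B) (Ω := V)
    (fun v => v ≠ 0 ∧ B v v = B v₀ v₀) v₀ (fun v => ⟨fun hv => ?_, ?_⟩)
    (fun g => f (fixedCard g.1)) (fun g h => congrArg f (fixedCard_mul_conj g.1 h.1))
  · refine Eq.trans h (uniformMean_of_bijective
      (fun a => (⟨Φ a, hfix a⟩ : MulAction.stabilizer (isometryGroup F B) v₀))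
      ⟨fun a b hab => hinj (congrArg Subtype.val hab), fun g => ?_⟩ fun _ => rfl).symm
    obtain ⟨a, ha⟩ := hsurj g.1 g.2
    exact ⟨a, Subtype.ext ha⟩
  · exact hB.exists_isometry_apply_eq hσ hv₀ hv.1 hv.2.symm
  · rintro ⟨g, rfl⟩
    exact ⟨fun h => hv₀ (g.1.map_eq_zero_iff.1 h), g.2 _ _⟩

end MeanFixed

/-! ### Stabilizers of anisotropic and isotropic vectors. -/

section Extensions

variable {F : Type*} [Field F] {V : Type*} [AddCommGroup V] [Module F V]

/-- The orthogonal sum of the standard line and a Hermitian space. -/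
def lineSumForm (σ : F →+* F) (B : V → V → F) (x y : F × V) : F :=
  x.1 * σ y.1 + B x.2 y.2

/-- The orthogonal sum of a hyperbolic plane and a Hermitian space. -/
def hyperbolicSumForm (σ : F →+* F) (B : V → V → F) (x y : F × V × F) : F :=
  x.1 * σ y.2.2 + x.2.2 * σ y.1 + B x.2.1 y.2.1

variable {σ : F →+* F} {B : V → V → F}

theorem IsHermitianForm.lineSum (hB : IsHermitianForm σ B) (hσ : ∀ x, σ (σ x) = x) :
    IsHermitianForm σ (lineSumForm σ B) where
  add_left x y z := by simp only [lineSumForm, Prod.fst_add, Prod.snd_add, hB.add_left]; ring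
  smul_left c x z := by
    simp only [lineSumForm, Prod.smul_fst, Prod.smul_snd, hB.smul_left, smul_eq_mul]; ring
  symm x y := by simp only [lineSumForm, map_add, map_mul, hB.symm, hσ]; ring
  nondeg x h := by
    refine Prod.ext ?_ (hB.nondeg _ fun y => ?_)
    · simpa [lineSumForm, hB.zero_right] using h (1, 0)
    · simpa [lineSumForm] using h (0, y)

theorem IsHermitianForm.hyperbolicSum (hB : IsHermitianForm σ B) (hσ : ∀ x, σ (σ x) = x) :
    IsHermitianForm σ (hyperbolicSumForm σ B) where
  add_left x y z := by
    simp only [hyperbolicSumForm, Prod.fst_add, Prod.snd_add, hB.add_left]; ring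
  smul_left c x z := by
    simp only [hyperbolicSumForm, Prod.smul_fst, Prod.smul_snd, hB.smul_left, smul_eq_mul]; ring
  symm x y := by simp only [hyperbolicSumForm, map_add, map_mul, hB.symm, hσ]; ring
  nondeg x h := by
    refine Prod.ext ?_ (Prod.ext (hB.nondeg _ fun y => ?_) ?_)
    · simpa [hyperbolicSumForm, hB.zero_right] using h (0, 0, 1)
    · simpa [hyperbolicSumForm] using h (0, y, 0)
    · simpa [hyperbolicSumForm, hB.zero_right] using h (1, 0, 0)

/-- The isometry of the orthogonal sum that extends an isometry by the identity. -/
def lineSumIsometry (σ : F →+* F) (h : isometryGroup F B) : isometryGroup F (lineSumForm σ B) :=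
  ⟨(LinearEquiv.refl F F).prodCongr h.1, fun x y => by
    simp [lineSumForm, h.2 x.2 y.2]⟩

theorem lineSumIsometry_apply (h : isometryGroup F B) (x : F × V) :
    (lineSumIsometry σ h).1 x = (x.1, h.1 x.2) := rfl

theorem fixedCard_lineSumIsometry (h : isometryGroup F B) :
    fixedCard (lineSumIsometry σ h).1 = Nat.card F * fixedCard h.1 := by
  rw [fixedCard, fixedCard, ← Nat.card_prod]
  refine Nat.card_congr
    { toFun := fun x => (x.1.1, ⟨x.1.2, congrArg Prod.snd x.2⟩)
      invFun := fun x => ⟨(x.1, x.2.1), Prod.ext rfl x.2.2⟩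
      left_inv := fun _ => rfl
      right_inv := fun _ => rfl }

/-- The contribution of the anisotropic vectors of a given norm to the orbit count. -/
theorem uniformMean_lineSum_anisotropic [Finite F] [Finite V] (hB : IsHermitianForm σ B) {q : ℕ}
    (hσ : IsQuadraticConj q σ) {c : F} (hc : σ c = c) (hc0 : c ≠ 0) (f : ℕ → ℝ) :
    uniformMean (fun g : isometryGroup F (lineSumForm σ B) =>
        (Nat.card {v // (v ≠ 0 ∧ lineSumForm σ B v v = c) ∧ g.1 v = v} : ℝ) * f (fixedCard g.1)) =
      meanFixed F B fun m => f (q ^ 2 * m) := by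
  obtain ⟨l, hl⟩ := hσ.exists_norm c hc
  have hl0 : l ≠ 0 := by rintro rfl; simp at hl; exact hc0 hl.symm
  have hB' := hB.lineSum hσ.invol
  have hnorm : lineSumForm σ B (l, 0) (l, 0) = c := by
    simp [lineSumForm, hB.zero_left, hl]
  have hne : ((l, 0) : F × V) ≠ 0 := fun h => hl0 (congrArg Prod.fst h)
  rw [← hnorm, hB'.uniformMean_card_fixed_mul hσ hne f (lineSumIsometry σ)]
  · simp only [fixedCard_lineSumIsometry, hσ.card]
    rfl
  · intro g h hgh
    refine Subtype.ext (LinearEquiv.ext fun x => ?_)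
    exact congrArg (fun k : isometryGroup F (lineSumForm σ B) => (k.1 (0, x)).2) hgh
  · intro h
    simp [lineSumIsometry_apply]
  · intro g hg
    have h1 : g.1 (1, 0) = (1, 0) := by
      have : ((1, 0) : F × V) = l⁻¹ • (l, 0) := by
        simp [hl0]
      rw [this, map_smul, hg]
    -- The first coordinate is the pairing with the fixed vector `(1, 0)`, so `g` preserves it and
    -- splits as the identity plus an isometry of `V`.
    have hfst : ∀ v, (g.1 v).1 = v.1 := fun v => by
      have := g.2 v (1, 0)
      simpa [h1, lineSumForm, hB.zero_right] using this
    obtain ⟨h, hh⟩ := hB.exists_isometry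
      ((LinearMap.snd F F V).comp (g.1.toLinearMap.comp (LinearMap.inr F F V))) fun x y => by
        have := g.2 (0, x) (0, y)
        simpa [lineSumForm, hfst] using this
    refine ⟨h, Subtype.ext (LinearEquiv.ext fun v => ?_)⟩
    have hv : v = v.1 • ((1, 0) : F × V) + (0, v.2) := by ext <;> simp
    rw [lineSumIsometry_apply]
    refine Prod.ext (hfst v).symm ?_
    conv_rhs => rw [hv, map_add, map_smul, h1]
    simp [hh]

/-- The stabilizer of an isotropic vector is parametrized by an isometry `h` of the smaller space
and the image `(c, u, 1)` of the second vector of the hyperbolic pair. -/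
abbrev HyperbolicParam (σ : F →+* F) (B : V → V → F) : Type _ :=
  isometryGroup F B × Σ u : V, {c : F // c + σ c + B u u = 0}

/-- The endomorphism of a hyperbolic sum with given parameters. -/
def hyperbolicMap (hB : IsHermitianForm σ B) (h : isometryGroup F B) (u : V) (c : F) :
    F × V × F →ₗ[F] F × V × F where
  toFun x := (x.1 - B (h.1 x.2.1) u + x.2.2 * c, h.1 x.2.1 + x.2.2 • u, x.2.2)
  map_add' x y := by
    refine Prod.ext ?_ (Prod.ext ?_ rfl)
    · simp only [Prod.fst_add, Prod.snd_add, map_add, hB.add_left]; ring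
    · simp only [Prod.fst_add, Prod.snd_add, map_add, add_smul]; abel
  map_smul' r x := by
    refine Prod.ext ?_ (Prod.ext ?_ rfl)
    · simp only [Prod.smul_fst, Prod.smul_snd, map_smul, hB.smul_left, smul_eq_mul,
        RingHom.id_apply]
      ring
    · simp only [Prod.smul_fst, Prod.smul_snd, map_smul, smul_eq_mul, RingHom.id_apply, smul_add,
        smul_smul]

/-- The term `-B (h x) u` in the first coordinate cancels the cross terms created by `u`, and `hc`
says that the image `(c, u, 1)` of `(0, 0, 1)` is again isotropic. -/
theorem hyperbolicMap_preserves (hB : IsHermitianForm σ B) (h : isometryGroup F B) (u : V) (c : F)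
    (hc : c + σ c + B u u = 0) (x y : F × V × F) :
    hyperbolicSumForm σ B (hyperbolicMap hB h u c x) (hyperbolicMap hB h u c y) =
      hyperbolicSumForm σ B x y := by
  have hh := h.2 x.2.1 y.2.1
  simp only [hyperbolicSumForm, hyperbolicMap, LinearMap.coe_mk, AddHom.coe_mk, map_add, map_sub,
    map_mul, hB.add_left, hB.add_right, hB.smul_left, hB.smul_right, hB.symm]
  linear_combination hh + x.2.2 * σ y.2.2 * hc

theorem exists_hyperbolicIsometry [Finite F] [Finite V] (hB : IsHermitianForm σ B)
    (hσ : ∀ x, σ (σ x) = x) :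
    ∃ Φ : HyperbolicParam σ B → isometryGroup F (hyperbolicSumForm σ B),
      ∀ p x, (Φ p).1 x = hyperbolicMap hB p.1 p.2.1 p.2.2.1 x := by
  have h : ∀ p : HyperbolicParam σ B, ∃ g : isometryGroup F (hyperbolicSumForm σ B),
      ∀ x, g.1 x = hyperbolicMap hB p.1 p.2.1 p.2.2.1 x := fun p =>
    (hB.hyperbolicSum hσ).exists_isometry _
      (hyperbolicMap_preserves hB p.1 p.2.1 p.2.2.1 p.2.2.2)
  choose Φ hΦ using h
  exact ⟨Φ, hΦ⟩

/-- The last coordinate is the pairing with the fixed vector `(1, 0, 0)`, hence is preserved. The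
middle component on `V` is then an isometry `h`, and the image of `(0, 0, 1)` supplies `u` and `c`;
pairing with that image forces the first coordinate on `V`. -/
theorem exists_hyperbolicMap_eq [Finite F] [Finite V] (hB : IsHermitianForm σ B)
    (g : isometryGroup F (hyperbolicSumForm σ B)) (hg : g.1 (1, 0, 0) = (1, 0, 0)) :
    ∃ p : HyperbolicParam σ B, ∀ x, g.1 x = hyperbolicMap hB p.1 p.2.1 p.2.2.1 x := by
  have hthd : ∀ v, (g.1 v).2.2 = v.2.2 := fun v => by
    have := g.2 v (1, 0, 0)
    simpa [hg, hyperbolicSumForm, hB.zero_right] using this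
  obtain ⟨h, hh⟩ := hB.exists_isometry
    ((LinearMap.fst F V F).comp ((LinearMap.snd F F (V × F)).comp
      (g.1.toLinearMap.comp ((LinearMap.inr F F (V × F)).comp (LinearMap.inl F V F))))) fun x y => by
        have := g.2 (0, x, 0) (0, y, 0)
        simpa [hyperbolicSumForm, hthd] using this
  have hh' : ∀ x, h.1 x = (g.1 (0, x, 0)).2.1 := fun x => hh x
  set u := (g.1 (0, 0, 1)).2.1 with hu
  set c := (g.1 (0, 0, 1)).1 with hc
  have hcu : c + σ c + B u u = 0 := by
    have := g.2 (0, 0, 1) (0, 0, 1)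
    simpa [hyperbolicSumForm, hthd, hB.zero_right, ← hu, ← hc] using this
  have hfst : ∀ x, (g.1 (0, x, 0)).1 = -B (h.1 x) u := fun x => by
    have := g.2 (0, x, 0) (0, 0, 1)
    simp only [hyperbolicSumForm, hthd, hB.zero_right, map_one, mul_one, zero_mul, add_zero,
      ← hu, ← hh'] at this
    simpa using eq_neg_of_add_eq_zero_left this
  refine ⟨(h, ⟨u, c, hcu⟩), fun v => ?_⟩
  have hv : v = v.1 • ((1, 0, 0) : F × V × F) + (0, v.2.1, 0) + v.2.2 • ((0, 0, 1) : F × V × F) := by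
    ext <;> simp
  have h3 := hthd v
  rw [hyperbolicMap]
  refine Prod.ext ?_ (Prod.ext ?_ h3)
  · conv_lhs => rw [hv, map_add, map_add, map_smul, map_smul, hg]
    simp [hfst, ← hc, sub_eq_add_neg]
  · conv_lhs => rw [hv, map_add, map_add, map_smul, map_smul, hg]
    simp [hh', ← hu]

end Extensions

/-! ### Counting fixed vectors in the stabilizer of an isotropic vector. -/

section StabilizerCount

variable {F : Type*} [Field F] {V : Type*} [AddCommGroup V] [Module F V]
  {σ : F →+* F} {B : V → V → F}

/-- The endomorphism `g - 1`. -/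
def displacement (g : V ≃ₗ[F] V) : V →ₗ[F] V :=
  g.toLinearMap - LinearMap.id

theorem mem_ker_displacement (g : V ≃ₗ[F] V) (v : V) :
    v ∈ LinearMap.ker (displacement g) ↔ g v = v := by
  simp [displacement, sub_eq_zero]

theorem card_range_displacement_mul (g : V ≃ₗ[F] V) :
    Nat.card (LinearMap.range (displacement g)) * fixedCard g = Nat.card V := by
  have h1 : fixedCard g = Nat.card (displacement g).toAddMonoidHom.ker :=
    Nat.card_congr (Equiv.subtypeEquivRight fun v => (mem_ker_displacement g v).symm)
  have h2 : Nat.card (LinearMap.range (displacement g)) =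
      Nat.card (displacement g).toAddMonoidHom.range := Nat.card_congr (Equiv.refl _)
  rw [h1, h2, ← AddSubgroup.index_ker, mul_comm, AddSubgroup.card_mul_index]

/-- Fixed vectors of an isometry in the stabilizer of an isotropic vector. -/
theorem card_fixed_hyperbolicMap (hB : IsHermitianForm σ B) (h : isometryGroup F B) (u : V)
    (c : F) :
    Nat.card {x // hyperbolicMap hB h u c x = x} =
      Nat.card F * Nat.card {y : V × F // h.1 y.1 + y.2 • u = y.1 ∧ y.2 * c = B (h.1 y.1) u} := by
  rw [← Nat.card_prod]
  refine Nat.card_congr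
    { toFun := fun x => (x.1.1, ⟨x.1.2, congrArg (fun t => t.2.1) x.2, ?_⟩)
      invFun := fun x => ⟨(x.1, x.2.1), ?_⟩
      left_inv := fun _ => rfl
      right_inv := fun _ => rfl }
  · have := congrArg Prod.fst x.2
    simp only [hyperbolicMap, LinearMap.coe_mk, AddHom.coe_mk] at this
    linear_combination this
  · refine Prod.ext ?_ (Prod.ext x.2.2.1 rfl)
    have := x.2.2.2
    simp only [hyperbolicMap, LinearMap.coe_mk, AddHom.coe_mk]
    linear_combination this

/-- For `u = h y - y` the substitution `k = x + b • y` turns the equations for a fixed vector into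
`h k = k` and `b * t = 0`, because fixed vectors of `h` are orthogonal to the image of `h - 1`. The
parameter `t` is the shift of `c` that turns the constraint on `c` into trace zero. -/
theorem card_fixed_hyperbolicMap_of_eq (hB : IsHermitianForm σ B) (h : isometryGroup F B)
    (y : V) (t : F) [Decidable (t = 0)] :
    Nat.card {x // hyperbolicMap hB h (displacement h.1 y)
        (t - B (h.1 y) (displacement h.1 y)) x = x} =
      Nat.card F * if t = 0 then Nat.card F * fixedCard h.1 else fixedCard h.1 := by
  rw [card_fixed_hyperbolicMap]
  congr 1
  have key : Nat.card {x : V × F // h.1 x.1 + x.2 • displacement h.1 y = x.1 ∧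
        x.2 * (t - B (h.1 y) (displacement h.1 y)) = B (h.1 x.1) (displacement h.1 y)} =
      Nat.card ({k // h.1 k = k} × {b : F // b * t = 0}) := by
    have hD : ∀ y, displacement h.1 y = h.1 y - y := fun _ => rfl
    have horth : ∀ k, h.1 k = k → B k (displacement h.1 y) = 0 := fun k hk => by
      have := h.2 k y
      rw [hk] at this
      rw [hD, hB.sub_right, this, sub_self]
    have hfix : ∀ x : V × F, h.1 x.1 + x.2 • displacement h.1 y = x.1 →
        h.1 (x.1 + x.2 • y) = x.1 + x.2 • y := fun x h1 => by
      rw [hD, smul_sub] at h1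
      rw [map_add, map_smul]
      nth_rewrite 2 [← h1]
      abel
    refine Nat.card_congr
      { toFun := fun x => (⟨x.1.1 + x.1.2 • y, hfix _ x.2.1⟩, ⟨x.1.2, ?_⟩)
        invFun := fun x => ⟨(x.1.1 - x.2.1 • y, x.2.1), ?_, ?_⟩
        left_inv := fun x => by simp
        right_inv := fun x => by simp }
    · have hk := hfix _ x.2.1
      have h2 := horth _ hk
      have h3 := x.2.2
      rw [← hk, map_add, map_smul, hB.add_left, hB.smul_left] at h2
      linear_combination h3 + h2
    · simp only [map_sub, map_smul, x.1.2, hD, smul_sub]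
      abel
    · have h1 := horth _ x.1.2
      have h2 := x.2.2
      simp only [map_sub, map_smul, x.1.2, hB.sub_left, hB.smul_left]
      linear_combination h2 - h1
  rw [key, Nat.card_prod]
  split_ifs with ht
  · subst ht
    have : Nat.card {b : F // b * 0 = 0} = Nat.card F :=
      Nat.card_congr (Equiv.subtypeUnivEquiv fun b => mul_zero b)
    rw [this, mul_comm]
    rfl
  · have : Nat.card {b : F // b * t = 0} = 1 := by
      have : Unique {b : F // b * t = 0} :=
        { default := ⟨0, zero_mul t⟩
          uniq := fun b => Subtype.ext ((mul_eq_zero.1 b.2).resolve_right ht) }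
      exact Nat.card_unique
    rw [this, mul_one]
    rfl

variable [Finite F] [Finite V]

/-- The map `z ↦ B(·, z)` is only semilinear; it is injective by nondegeneracy, and surjective
because a finite space and its dual have the same cardinality. -/
theorem IsHermitianForm.exists_eq_of_dual (hB : IsHermitianForm σ B) (φ : Module.Dual F V) :
    ∃ z, ∀ x, φ x = B x z := by
  let T : V → Module.Dual F V := fun z =>
    { toFun := fun x => B x z
      map_add' := fun x y => hB.add_left x y z
      map_smul' := fun c x => hB.smul_left c x z }
  have hinj : Function.Injective T := fun z w hzw => by
    rw [← sub_eq_zero]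
    refine hB.nondeg_right _ fun x => ?_
    rw [hB.sub_right, sub_eq_zero]
    exact LinearMap.congr_fun hzw x
  have hcard : Nat.card V = Nat.card (Module.Dual F V) :=
    Nat.card_congr (Module.finBasis F V).toDualEquiv.toEquiv
  have : Finite (Module.Dual F V) := DFunLike.finite _
  obtain ⟨z, hz⟩ := ((Nat.bijective_iff_injective_and_card T).2 ⟨hinj, hcard⟩).2 φ
  exact ⟨z, fun x => (LinearMap.congr_fun hz x).symm⟩

/-- A vector orthogonal to the fixed vectors of an isometry `h` is in the image of `h - 1`. -/
theorem IsHermitianForm.mem_range_displacement (hB : IsHermitianForm σ B) (h : isometryGroup F B)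
    (u : V) (hu : ∀ k, h.1 k = k → B k u = 0) : u ∈ LinearMap.range (displacement h.1) := by
  by_contra hne
  -- Separate `u` from the image by a functional and represent it by a vector `z`. Since `z` is
  -- orthogonal to the image of `h - 1`, it is fixed by `h`, hence orthogonal to `u`: a
  -- contradiction.
  obtain ⟨φ, hφu, hφ⟩ := Submodule.exists_le_ker_of_notMem hne
  obtain ⟨z, hz⟩ := hB.exists_eq_of_dual φ
  have hfix : h.1 z = z := by
    rw [eq_comm, ← sub_eq_zero]
    refine hB.nondeg_right _ fun y => ?_
    have h1 : φ (displacement h.1 (h.1.symm y)) = 0 :=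
      hφ (LinearMap.mem_range_self _ _)
    have h2 := h.2 (h.1.symm y) z
    rw [h.1.apply_symm_apply] at h2
    simp only [displacement, LinearMap.sub_apply, LinearEquiv.coe_coe, h.1.apply_symm_apply,
      LinearMap.id_apply, hz] at h1
    rw [hB.sub_right, h2, ← hB.sub_left, h1]
  refine hφu ?_
  rw [hz, ← hB.symm, hu z hfix, map_zero]

/-- A fixed vector must have last coordinate zero, since otherwise `u` would be in the image of `h -
1`. Its middle component then lies in a hyperplane of the fixed space of `h`, and the free first
coordinate compensates for the lost factor `Nat.card F`. -/
theorem card_fixed_hyperbolicMap_of_notMem (hB : IsHermitianForm σ B) (h : isometryGroup F B)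
    (u : V) (c : F) (hu : u ∉ LinearMap.range (displacement h.1)) :
    Nat.card {x // hyperbolicMap hB h u c x = x} = fixedCard h.1 := by
  rw [card_fixed_hyperbolicMap]
  let K := LinearMap.ker (displacement h.1)
  let ℓ : K →ₗ[F] F :=
    { toFun := fun x => B x.1 u
      map_add' := fun x y => hB.add_left x.1 y.1 u
      map_smul' := fun c x => hB.smul_left c x.1 u }
  have hsurj : Function.Surjective ℓ := by
    refine LinearMap.surjective fun h0 => hu (hB.mem_range_displacement h u fun k hk => ?_)
    exact LinearMap.congr_fun h0 ⟨k, (mem_ker_displacement h.1 k).2 hk⟩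
  have hcard : Nat.card ℓ.toAddMonoidHom.ker * Nat.card F = fixedCard h.1 := by
    have h1 : fixedCard h.1 = Nat.card K :=
      Nat.card_congr (Equiv.subtypeEquivRight fun v => (mem_ker_displacement h.1 v).symm)
    have h2 : Nat.card F = Nat.card ℓ.toAddMonoidHom.range := by
      rw [AddMonoidHom.range_eq_top.2 hsurj]
      exact (Nat.card_congr AddSubgroup.topEquiv.toEquiv).symm
    rw [h1, h2, ← AddSubgroup.index_ker, AddSubgroup.card_mul_index]
  rw [← hcard, mul_comm]
  congr 1
  have hb : ∀ y : V × F, h.1 y.1 + y.2 • u = y.1 → y.2 = 0 := by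
    intro y hy
    by_contra hb0
    refine hu ⟨-(y.2⁻¹ • y.1), ?_⟩
    have h3 : y.1 - h.1 y.1 = y.2 • u := by
      rw [sub_eq_iff_eq_add', hy]
    simp only [displacement, LinearMap.sub_apply, LinearEquiv.coe_coe, LinearMap.id_apply, map_neg,
      map_smul]
    rw [← smul_neg, neg_sub, h3, smul_smul, inv_mul_cancel₀ hb0, one_smul]
  refine Nat.card_congr
    { toFun := fun y => ⟨⟨y.1.1, ?_⟩, ?_⟩
      invFun := fun x => ⟨(x.1.1, 0), ?_⟩
      left_inv := fun y => Subtype.ext (Prod.ext rfl (hb y.1 y.2.1).symm)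
      right_inv := fun _ => rfl }
  · have := y.2.1
    rw [hb y.1 y.2.1, zero_smul, add_zero] at this
    exact (mem_ker_displacement h.1 _).2 this
  · have h1 := y.2.1
    have h2 := y.2.2
    rw [hb y.1 y.2.1, zero_smul, add_zero] at h1
    rw [hb y.1 y.2.1, zero_mul, h1] at h2
    exact h2.symm
  · have h1 := (mem_ker_displacement h.1 _).1 x.1.2
    have h2 : B x.1.1 u = 0 := x.2
    simp [h1, h2]

end StabilizerCount

/-! ### The contribution of isotropic vectors. -/

section IsotropicMean

variable {F : Type*} [Field F] {V : Type*} [AddCommGroup V] [Module F V]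
  {σ : F →+* F} {B : V → V → F} {q : ℕ}

/-- Translating the elements of trace zero. -/
def traceFiberEquiv (σ : F →+* F) {b s : F} (hs : s + σ s = b) :
    {t : F // t + σ t = 0} ≃ {c : F // c + σ c + b = 0} where
  toFun t := ⟨t.1 - s, by rw [map_sub]; linear_combination t.2 - hs⟩
  invFun c := ⟨c.1 + s, by rw [map_add]; linear_combination c.2 + hs⟩
  left_inv t := by simp
  right_inv c := by simp

theorem IsQuadraticConj.card_trace_fiber (hσ : IsQuadraticConj q σ) {b : F} (hb : σ b = b) :
    Nat.card {c : F // c + σ c + b = 0} = q := by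
  obtain ⟨s, hs⟩ := hσ.exists_trace b hb
  rw [← hσ.card_trace_zero, Nat.card_congr (traceFiberEquiv σ hs)]

theorem IsQuadraticConj.sum_trace_zero_ite (hσ : IsQuadraticConj q σ) (A C : ℝ)
    [Fintype {t : F // t + σ t = 0}] [DecidableEq F] :
    (∑ t : {t : F // t + σ t = 0}, if t.1 = 0 then A else C) = A + (q - 1) * C := by
  have h0 : (0 : F) + σ 0 = 0 := by simp
  have h1 : ∀ t : {t : F // t + σ t = 0},
      (if t.1 = 0 then A else C) = C + if t = ⟨0, h0⟩ then A - C else 0 := fun t => by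
    by_cases ht : t.1 = 0
    · have : t = ⟨0, h0⟩ := Subtype.ext ht
      rw [if_pos ht, if_pos this]; ring
    · have : t ≠ ⟨0, h0⟩ := fun h => ht (congrArg Subtype.val h)
      rw [if_neg ht, if_neg this, add_zero]
  rw [Finset.sum_congr rfl fun t _ => h1 t, Finset.sum_add_distrib, Finset.sum_ite_eq',
    if_pos (Finset.mem_univ _), Finset.sum_const, Finset.card_univ, ← Nat.card_eq_fintype_card,
    hσ.card_trace_zero, nsmul_eq_mul]
  ring

variable [Finite F] [Finite V]

/-- The mean over the isometries that fix an isotropic vector and induce a given isometry `h`. -/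
theorem uniformMean_hyperbolicMap (hB : IsHermitianForm σ B) (hσ : IsQuadraticConj q σ)
    (h : isometryGroup F B) (f : ℕ → ℝ) :
    uniformMean (fun p : Σ u : V, {c : F // c + σ c + B u u = 0} =>
        f (Nat.card {x // hyperbolicMap hB h p.1 p.2.1 x = x})) =
      (1 - 1 / (fixedCard h.1 : ℝ)) * f (fixedCard h.1) + 1 / (fixedCard h.1 : ℝ) *
        ((1 - 1 / (q : ℝ)) * f (q ^ 2 * fixedCard h.1) +
          1 / (q : ℝ) * f (q ^ 4 * fixedCard h.1)) := by
  classical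
  have := Fintype.ofFinite F
  have := Fintype.ofFinite V
  set Q := fixedCard h.1 with hQ
  set R := LinearMap.range (displacement h.1) with hR
  have hcardfib : ∀ u : V, Fintype.card {c : F // c + σ c + B u u = 0} = q := fun u => by
    rw [← Nat.card_eq_fintype_card, hσ.card_trace_fiber (hB.symm u u)]
  -- The image `R` of `h - 1` makes up a proportion `1 / Q` of `V`. For `u` in `R`, one of the `q`
  -- values of `c` corresponds to `t = 0` and gives `q ^ 4 * Q`, the others give `q ^ 2 * Q`; for
  -- `u` outside `R` every `c` gives `Q`.
  have hin : ∀ u : V, (∑ c : {c : F // c + σ c + B u u = 0},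
      f (Nat.card {x // hyperbolicMap hB h u c.1 x = x})) =
        q * f Q + if u ∈ R then (f (q ^ 4 * Q) + (q - 1) * f (q ^ 2 * Q)) - q * f Q else 0 := by
    intro u
    split_ifs with hu
    · obtain ⟨y, rfl⟩ := hu
      have hs : B (h.1 y) (displacement h.1 y) + σ (B (h.1 y) (displacement h.1 y)) =
          B (displacement h.1 y) (displacement h.1 y) := by
        have hD : displacement h.1 y = h.1 y - y := rfl
        have h1 := h.2 y y
        rw [hB.symm, hD]
        simp only [hB.sub_left, hB.sub_right]
        linear_combination h1
      rw [← Equiv.sum_comp (traceFiberEquiv σ hs)]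
      have h2 : ∀ t : {t : F // t + σ t = 0}, f (Nat.card {x // hyperbolicMap hB h
          (displacement h.1 y) (traceFiberEquiv σ hs t).1 x = x}) =
          if t.1 = 0 then f (q ^ 4 * Q) else f (q ^ 2 * Q) := fun t => by
        rw [traceFiberEquiv, Equiv.coe_fn_mk, card_fixed_hyperbolicMap_of_eq, hσ.card]
        split_ifs
        · rw [← mul_assoc, ← pow_add]
        · rfl
      rw [Finset.sum_congr rfl fun t _ => h2 t, hσ.sum_trace_zero_ite]
      ring
    · rw [Finset.sum_congr rfl fun c _ => by rw [card_fixed_hyperbolicMap_of_notMem hB h u c.1 hu],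
        Finset.sum_const, Finset.card_univ, hcardfib, nsmul_eq_mul, add_zero]
  have hcard : (Nat.card (Σ u : V, {c : F // c + σ c + B u u = 0}) : ℝ) = Nat.card V * q := by
    rw [Nat.card_eq_fintype_card, Fintype.card_sigma,
      Finset.sum_congr rfl fun u _ => hcardfib u, Finset.sum_const, Finset.card_univ,
      ← Nat.card_eq_fintype_card, smul_eq_mul, Nat.cast_mul]
  have hRQ : (Nat.card R : ℝ) * Q = Nat.card V := by
    exact_mod_cast card_range_displacement_mul h.1
  have hQ0 : (Q : ℝ) ≠ 0 := by
    have : 0 < Q := by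
      have : Nonempty {v // h.1 v = v} := ⟨⟨0, map_zero _⟩⟩
      exact Nat.card_pos
    exact_mod_cast this.ne'
  have hR0 : (Nat.card R : ℝ) ≠ 0 := by exact_mod_cast Nat.card_pos.ne'
  have hq0 : (q : ℝ) ≠ 0 := by
    have := hσ.two_le
    exact_mod_cast (by omega : q ≠ 0)
  rw [uniformMean_eq_sum, Fintype.sum_sigma, Finset.sum_congr rfl fun u _ => hin u,
    Finset.sum_add_distrib, Finset.sum_const, ← Finset.sum_filter, Finset.sum_const, hcard,
    ← Fintype.card_subtype, Finset.card_univ, ← Nat.card_eq_fintype_card (α := V),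
    ← Nat.card_eq_fintype_card, nsmul_eq_mul, nsmul_eq_mul, ← hRQ]
  change ((Nat.card R : ℝ) * Q * _ + (Nat.card R : ℝ) * _) / _ = _
  field_simp
  ring

/-- The contribution of the isotropic vectors to the orbit count. -/
theorem uniformMean_hyperbolicSum_isotropic (hB : IsHermitianForm σ B)
    (hσ : IsQuadraticConj q σ) (f : ℕ → ℝ) :
    uniformMean (fun g : isometryGroup F (hyperbolicSumForm σ B) =>
        (Nat.card {v // (v ≠ 0 ∧ hyperbolicSumForm σ B v v = 0) ∧ g.1 v = v} : ℝ) *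
          f (fixedCard g.1)) =
      meanFixed F B fun m => (1 - 1 / (m : ℝ)) * f m + 1 / (m : ℝ) *
        ((1 - 1 / (q : ℝ)) * f (q ^ 2 * m) + 1 / (q : ℝ) * f (q ^ 4 * m)) := by
  have hB' := hB.hyperbolicSum hσ.invol
  obtain ⟨Φ, hΦ⟩ := exists_hyperbolicIsometry hB hσ.invol
  have hne : ((1, 0, 0) : F × V × F) ≠ 0 := fun h => one_ne_zero (congrArg Prod.fst h)
  have hnorm : hyperbolicSumForm σ B (1, 0, 0) (1, 0, 0) = 0 := by
    simp [hyperbolicSumForm, hB.zero_left]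
  rw [← hnorm, hB'.uniformMean_card_fixed_mul hσ hne f Φ]
  · have : ∀ p, fixedCard (Φ p).1 =
        Nat.card {x // hyperbolicMap hB p.1 p.2.1 p.2.2.1 x = x} := fun p =>
      Nat.card_congr (Equiv.subtypeEquivRight fun x => by rw [hΦ])
    simp only [this]
    rw [uniformMean_prod]
    simp only [uniformMean_hyperbolicMap hB hσ]
    rfl
  · intro p p' hpp
    have h1 : ∀ x, hyperbolicMap hB p.1 p.2.1 p.2.2.1 x = hyperbolicMap hB p'.1 p'.2.1 p'.2.2.1 x :=
      fun x => by rw [← hΦ, ← hΦ, hpp]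
    obtain ⟨h, u, c, hc⟩ := p
    obtain ⟨h', u', c', hc'⟩ := p'
    have h2 : h = h' := by
      refine Subtype.ext (LinearEquiv.ext fun x => ?_)
      simpa [hyperbolicMap] using congrArg (fun t => t.2.1) (h1 (0, x, 0))
    have h3 : u = u' := by
      simpa [hyperbolicMap] using congrArg (fun t => t.2.1) (h1 (0, 0, 1))
    have h4 : c = c' := by
      simpa [hyperbolicMap, hB.zero_left] using congrArg (fun t => t.1) (h1 (0, 0, 1))
    subst h2 h3 h4
    rfl
  · intro p
    rw [hΦ]
    simp [hyperbolicMap, hB.zero_left]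
  · intro g hg
    obtain ⟨p, hp⟩ := exists_hyperbolicMap_eq hB g hg
    exact ⟨p, Subtype.ext (LinearEquiv.ext fun x => by rw [hΦ, hp])⟩

end IsotropicMean

/-! ### The recursion in the dimension. -/

section Recursion

variable {F : Type*} [Field F] {V : Type*} [AddCommGroup V] [Module F V]
  {σ : F →+* F} {B : V → V → F} {q : ℕ}

/-- The mean, over the isometry group, of the number of nonzero isotropic fixed vectors times a
function of the number of fixed vectors. -/
noncomputable def isotropicMean (F : Type*) [Field F] {V : Type*} [AddCommGroup V] [Module F V]
    (B : V → V → F) (f : ℕ → ℝ) : ℝ :=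
  uniformMean fun g : isometryGroup F B =>
    (Nat.card {v // (v ≠ 0 ∧ B v v = 0) ∧ g.1 v = v} : ℝ) * f (fixedCard g.1)

theorem isotropicMean_congr {W : Type*} [AddCommGroup W] [Module F W] {B' : W → W → F}
    (e : V ≃ₗ[F] W) (he : ∀ x y, B' (e x) (e y) = B x y) (f : ℕ → ℝ) :
    isotropicMean F B f = isotropicMean F B' f :=
  uniformMean_isometryGroup_congr e he fun g g' h => by
    rw [fixedCard_conj e g.1 g'.1 h]
    congr 2
    refine Nat.card_congr (e.toEquiv.subtypeEquiv fun v => ?_)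
    simp [h, he]

theorem isotropicMean_eq_zero (h : ∀ v, B v v = 0 → v = 0) (f : ℕ → ℝ) :
    isotropicMean F B f = 0 := by
  have h0 : ∀ g : isometryGroup F B,
      Nat.card {v // (v ≠ 0 ∧ B v v = 0) ∧ g.1 v = v} = 0 := fun g => by
    have : IsEmpty {v // (v ≠ 0 ∧ B v v = 0) ∧ g.1 v = v} :=
      ⟨fun v => v.2.1.1 (h v.1 v.2.1.2)⟩
    exact Nat.card_of_isEmpty
  simp [isotropicMean, h0, uniformMean]

section Finite

variable [Finite V]

/-- Fixed vectors sorted by their norm. -/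
theorem fixedCard_sub_one (hB : IsHermitianForm σ B) (g : V ≃ₗ[F] V)
    [Fintype {c : F // σ c = c}] :
    (fixedCard g : ℝ) - 1 =
      ∑ c : {c : F // σ c = c}, (Nat.card {v // (v ≠ 0 ∧ B v v = c) ∧ g v = v} : ℝ) := by
  have h1 : fixedCard g = Nat.card {v // v ≠ 0 ∧ g v = v} + 1 := by
    have h0 : (0 : V) ∈ {v | g v = v} := map_zero g
    have h2 : {v | v ≠ 0 ∧ g v = v} = {v | g v = v} \ {0} := by
      ext v; simp [and_comm]
    change Set.ncard {v | g v = v} = Set.ncard {v | v ≠ 0 ∧ g v = v} + 1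
    rw [h2, Set.ncard_sdiff_singleton_add_one h0 (Set.toFinite _)]
  have h2 : Nat.card {v // v ≠ 0 ∧ g v = v} =
      ∑ c : {c : F // σ c = c}, Nat.card {v // (v ≠ 0 ∧ B v v = c) ∧ g v = v} := by
    rw [← Nat.card_sigma]
    refine Nat.card_congr
      { toFun := fun v => ⟨⟨B v.1 v.1, hB.symm _ _⟩, v.1, ⟨v.2.1, rfl⟩, v.2.2⟩
        invFun := fun p => ⟨p.2.1, p.2.2.1.1, p.2.2.2⟩
        left_inv := fun _ => rfl
        right_inv := fun p => ?_ }
    obtain ⟨⟨c, hc⟩, v, hv⟩ := p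
    obtain rfl : B v v = c := hv.1.2
    rfl
  rw [h1, h2]
  push_cast
  ring

variable [Finite F]

/-- Counting fixed vectors in the orthogonal sum of a line and a Hermitian space. -/
theorem meanFixed_lineSum (hB : IsHermitianForm σ B) (hσ : IsQuadraticConj q σ) (f : ℕ → ℝ) :
    meanFixed F (lineSumForm σ B) (fun m => ((m : ℝ) - 1) * f m) =
      (q - 1) * meanFixed F B (fun m => f (q ^ 2 * m)) +
        isotropicMean F (lineSumForm σ B) f := by
  classical
  have := Fintype.ofFinite F
  have hB' := hB.lineSum hσ.invol
  have h0 : σ 0 = 0 := map_zero σ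
  unfold meanFixed
  simp only [fixedCard_sub_one hB', Finset.sum_mul]
  rw [uniformMean_sum, ← Finset.add_sum_erase _ _ (Finset.mem_univ (⟨0, h0⟩ : {c : F // σ c = c})),
    add_comm]
  congr 1
  rw [Finset.sum_congr rfl fun c hc => uniformMean_lineSum_anisotropic hB hσ c.2
    (fun h => (Finset.mem_erase.1 hc).1 (Subtype.ext h)) f, Finset.sum_const,
    Finset.card_erase_of_mem (Finset.mem_univ _), Finset.card_univ, ← Nat.card_eq_fintype_card,
    hσ.card_fixed, nsmul_eq_mul, Nat.cast_sub (by have := hσ.two_le; omega), Nat.cast_one]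
  rfl

/-- The sum of two standard lines is a hyperbolic plane. -/
theorem exists_hyperbolic_isometry (hB : IsHermitianForm σ B) (hσ : IsQuadraticConj q σ) :
    ∃ e : (F × V × F) ≃ₗ[F] (F × F × V), ∀ x y,
      lineSumForm σ (lineSumForm σ B) (e x) (e y) = hyperbolicSumForm σ B x y := by
  -- With `n` of norm `-1` and `l` of trace `-1`, the vectors `(1, n)` and `(1 + l, l * n)` are
  -- isotropic with pairing 1, so they form a hyperbolic pair.
  obtain ⟨n, hn⟩ := hσ.exists_norm (-1) (by simp)
  obtain ⟨l, hl⟩ := hσ.exists_trace (-1) (by simp)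
  let T : F × V × F →ₗ[F] F × F × V :=
    { toFun := fun x => (x.1 + x.2.2 * (1 + l), (x.1 + x.2.2 * l) * n, x.2.1)
      map_add' := fun x y => by
        refine Prod.ext ?_ (Prod.ext ?_ rfl)
        · simp only [Prod.fst_add, Prod.snd_add]; ring
        · simp only [Prod.fst_add, Prod.snd_add]; ring
      map_smul' := fun c x => by
        refine Prod.ext ?_ (Prod.ext ?_ rfl)
        · simp only [Prod.smul_fst, Prod.smul_snd, smul_eq_mul, RingHom.id_apply]; ring
        · simp only [Prod.smul_fst, Prod.smul_snd, smul_eq_mul, RingHom.id_apply]; ring }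
  have hT : ∀ x y, lineSumForm σ (lineSumForm σ B) (T x) (T y) = hyperbolicSumForm σ B x y := by
    intro x y
    simp only [T, LinearMap.coe_mk, AddHom.coe_mk, lineSumForm, hyperbolicSumForm, map_add,
      map_mul, map_one]
    linear_combination (x.1 + x.2.2 * l) * (σ y.1 + σ y.2.2 * σ l) * hn +
      x.2.2 * σ y.2.2 * hl
  have hinj := (hB.hyperbolicSum hσ.invol).injective_of_preserves
    ((hB.lineSum hσ.invol).lineSum hσ.invol) T hT
  have hcard : Nat.card (F × V × F) = Nat.card (F × F × V) := by
    simp only [Nat.card_prod]; ring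
  exact ⟨LinearEquiv.ofBijective T ((Nat.bijective_iff_injective_and_card T).2 ⟨hinj, hcard⟩), hT⟩

theorem isotropicMean_lineSum_lineSum (hB : IsHermitianForm σ B) (hσ : IsQuadraticConj q σ)
    (f : ℕ → ℝ) :
    isotropicMean F (lineSumForm σ (lineSumForm σ B)) f =
      meanFixed F B fun m => (1 - 1 / (m : ℝ)) * f m + 1 / (m : ℝ) *
        ((1 - 1 / (q : ℝ)) * f (q ^ 2 * m) + 1 / (q : ℝ) * f (q ^ 4 * m)) := by
  obtain ⟨e, he⟩ := exists_hyperbolic_isometry hB hσ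
  rw [← isotropicMean_congr e he]
  exact uniformMean_hyperbolicSum_isotropic hB hσ f

end Finite

/-- The standard Hermitian form, written with `σ`. -/
def standardForm (σ : F →+* F) (n : ℕ) (x y : Fin n → F) : F :=
  ∑ i, x i * σ (y i)

theorem isHermitianForm_standardForm (hσ : ∀ x, σ (σ x) = x) (n : ℕ) :
    IsHermitianForm σ (standardForm σ n) where
  add_left x y z := by simp [standardForm, add_mul, Finset.sum_add_distrib]
  smul_left c x z := by simp [standardForm, Finset.mul_sum, mul_assoc]
  symm x y := by simp [standardForm, map_sum, hσ, mul_comm]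
  nondeg x h := by
    funext i
    simpa [standardForm, Pi.single_apply, apply_ite σ] using h (Pi.single i 1)

theorem standardForm_cons (n : ℕ) (x y : F × (Fin n → F)) :
    standardForm σ (n + 1) (Fin.consLinearEquiv F (fun _ => F) x)
      (Fin.consLinearEquiv F (fun _ => F) y) = lineSumForm σ (standardForm σ n) x y := by
  simp [standardForm, lineSumForm, Fin.sum_univ_succ]

theorem lineSumForm_standardForm_cons (n : ℕ) (x y : F × F × (Fin n → F)) :
    lineSumForm σ (standardForm σ (n + 1))
      (((LinearEquiv.refl F F).prodCongr (Fin.consLinearEquiv F (fun _ => F))) x)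
      (((LinearEquiv.refl F F).prodCongr (Fin.consLinearEquiv F (fun _ => F))) y) =
      lineSumForm σ (lineSumForm σ (standardForm σ n)) x y := by
  have := standardForm_cons (σ := σ) n x.2 y.2
  simp only [lineSumForm, LinearEquiv.prodCongr_apply, LinearEquiv.refl_apply] at this ⊢
  rw [this]

variable [Finite F]

/-- A line has no nonzero isotropic vector, so only the nonzero norms contribute. -/
theorem meanFixed_standardForm_one (hσ : IsQuadraticConj q σ) (f : ℕ → ℝ) :
    meanFixed F (standardForm σ 1) (fun m => ((m : ℝ) - 1) * f m) =
      (q - 1) * meanFixed F (standardForm σ 0) (fun m => f (q ^ 2 * m)) := by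
  rw [← meanFixed_congr _ (standardForm_cons (σ := σ) 0),
    meanFixed_lineSum (isHermitianForm_standardForm hσ.invol 0) hσ, isotropicMean_eq_zero, add_zero]
  intro v hv
  simpa [lineSumForm, standardForm, Prod.ext_iff, eq_iff_true_of_subsingleton] using hv

/-- The nonzero norms lead to dimension `n + 1`. For norm zero, two standard lines are split off and
replaced by a hyperbolic plane, which leads to dimension `n`. -/
theorem meanFixed_standardForm_add_two (hσ : IsQuadraticConj q σ) (n : ℕ) (f : ℕ → ℝ) :
    meanFixed F (standardForm σ (n + 2)) (fun m => ((m : ℝ) - 1) * f m) =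
      (q - 1) * meanFixed F (standardForm σ (n + 1)) (fun m => f (q ^ 2 * m)) +
        meanFixed F (standardForm σ n) fun m => (1 - 1 / (m : ℝ)) * f m + 1 / (m : ℝ) *
          ((1 - 1 / (q : ℝ)) * f (q ^ 2 * m) + 1 / (q : ℝ) * f (q ^ 4 * m)) := by
  rw [← meanFixed_congr _ (standardForm_cons (σ := σ) (n + 1)),
    meanFixed_lineSum (isHermitianForm_standardForm hσ.invol (n + 1)) hσ,
    ← isotropicMean_congr _ (lineSumForm_standardForm_cons (σ := σ) n),
    isotropicMean_lineSum_lineSum (isHermitianForm_standardForm hσ.invol n) hσ]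

end Recursion

/-! ### From isometry groups to the matrix groups. -/

section UnitaryGroup

variable {F : Type*} [Field F]

theorem mem_isometryGroup_iff_mem_finiteUnitaryGroup {σ : F →+* F} {q : ℕ} (hσ : ∀ x, σ x = x ^ q)
    {n : ℕ} (g : Matrix.GeneralLinearGroup (Fin n) F) :
    (Matrix.GeneralLinearGroup.toLin.trans
      (LinearMap.GeneralLinearGroup.generalLinearEquiv F (Fin n → F))) g ∈
        isometryGroup F (standardForm σ n) ↔ g ∈ finiteUnitaryGroup q F n := by
  have h : ∀ x y : Fin n → F, standardForm σ n x y = hermitianForm q x y := fun x y => by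
    simp only [standardForm, hermitianForm, hσ]
  refine forall_congr' fun x => forall_congr' fun y => ?_
  rw [h, h]
  rfl

/-- The mean over the matrix group is the mean over the isometry group. -/
theorem uniformMean_finiteUnitaryGroup {σ : F →+* F} {q : ℕ} (hσ : ∀ x, σ x = x ^ q)
    (n : ℕ) (f : ℕ → ℝ) :
    uniformMean (fun g : finiteUnitaryGroup q F n => f (numFixedVectors g.1)) =
      meanFixed F (standardForm σ n) f :=
  uniformMean_of_bijective
    ((Matrix.GeneralLinearGroup.toLin.trans
      (LinearMap.GeneralLinearGroup.generalLinearEquiv F (Fin n → F))).toEquiv.subtypeEquiv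
        fun g => (mem_isometryGroup_iff_mem_finiteUnitaryGroup hσ g).symm)
    (Equiv.bijective _) fun _ => rfl

end UnitaryGroup

/-! ### Cauchy's identity and the total mass of the weights. -/

section CauchyIdentity

open Filter Topology

theorem qShifted_succ (A p : ℝ) (k : ℕ) :
    qShifted A p (k + 1) = qShifted A p k * (1 - A * p ^ k) :=
  Finset.prod_range_succ _ _

theorem qShiftedInf_eq_mul (A p : ℝ) (hp : |p| < 1) :
    qShiftedInf A p = (1 - A) * qShiftedInf (A * p) p := by
  have h := multipliable_qShiftedInf (A * p) p hp
  have heq : (fun i : ℕ => 1 - A * p * p ^ i) = fun i : ℕ => 1 - A * p ^ (i + 1) := by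
    funext i; ring
  rw [heq] at h
  have h1 := tprod_eq_zero_mul' (f := fun i : ℕ => 1 - A * p ^ i) h
  rw [pow_zero, mul_one] at h1
  rw [qShiftedInf, qShiftedInf, heq, h1]

theorem qShiftedInf_eq_qShifted_mul (A p : ℝ) (hp : |p| < 1) (k : ℕ) :
    qShiftedInf A p = qShifted A p k * qShiftedInf (A * p ^ k) p := by
  induction k with
  | zero => simp [qShifted]
  | succ k ih => rw [ih, qShifted_succ, qShiftedInf_eq_mul _ p hp]; ring_nf

/-- This one estimate gives both the limit at `A = 0` and the uniform bound needed for dominated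
convergence. -/
theorem abs_qShiftedInf_sub_one_le (A p : ℝ) (hp : |p| < 1) :
    |qShiftedInf A p - 1| ≤ Real.exp (|A| * (1 - |p|)⁻¹) - 1 := by
  have hlim := ((multipliable_qShiftedInf A p hp).hasProd.tendsto_prod_nat.sub_const 1).abs
  refine le_of_tendsto hlim (Eventually.of_forall fun n => ?_)
  have h := Finset.norm_prod_one_add_sub_one_le (Finset.range n) fun i => -(A * p ^ i)
  simp only [← sub_eq_add_neg, Real.norm_eq_abs, abs_neg, abs_mul, abs_pow] at h
  refine h.trans (sub_le_sub_right (Real.exp_le_exp.2 ?_) 1)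
  rw [← Finset.mul_sum]
  refine mul_le_mul_of_nonneg_left ?_ (abs_nonneg A)
  rw [← tsum_geometric_of_lt_one (abs_nonneg p) hp]
  exact (summable_geometric_of_lt_one (abs_nonneg p) hp).sum_le_tsum _
    fun i _ => pow_nonneg (abs_nonneg p) i

theorem abs_qShiftedInf_le {A C p : ℝ} (hp : |p| < 1) (hA : |A| ≤ C) :
    |qShiftedInf A p| ≤ Real.exp (C * (1 - |p|)⁻¹) := by
  have h1 := abs_qShiftedInf_sub_one_le A p hp
  have h2 : |qShiftedInf A p| ≤ |qShiftedInf A p - 1| + 1 := by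
    simpa using abs_add_le (qShiftedInf A p - 1) 1
  have h3 : Real.exp (|A| * (1 - |p|)⁻¹) ≤ Real.exp (C * (1 - |p|)⁻¹) :=
    Real.exp_le_exp.2 (mul_le_mul_of_nonneg_right hA (inv_nonneg.2 (by linarith)))
  linarith

theorem tendsto_qShiftedInf {p : ℝ} (hp : |p| < 1) {u : ℕ → ℝ} (hu : Tendsto u atTop (𝓝 0)) :
    Tendsto (fun m => qShiftedInf (u m) p) atTop (𝓝 1) := by
  rw [tendsto_iff_norm_sub_tendsto_zero]
  refine squeeze_zero (fun _ => norm_nonneg _) (fun m => abs_qShiftedInf_sub_one_le (u m) p hp) ?_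
  have h : Tendsto (fun m => Real.exp (|u m| * (1 - |p|)⁻¹) - 1) atTop
      (𝓝 (Real.exp (|(0 : ℝ)| * (1 - |p|)⁻¹) - 1)) :=
    ((Real.continuous_exp.tendsto _).comp (hu.abs.mul_const _)).sub_const 1
  simpa using h

theorem le_abs_qShifted {p : ℝ} (hp : |p| < 1) (k : ℕ) : (1 - |p|) ^ k ≤ |qShifted p p k| := by
  rw [qShifted, Finset.abs_prod]
  calc (1 - |p|) ^ k = ∏ _i ∈ Finset.range k, (1 - |p|) := by simp
    _ ≤ _ := Finset.prod_le_prod (fun _ _ => by linarith) fun i _ => ?_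
  have h1 : |p * p ^ i| ≤ |p| := by
    rw [abs_mul, abs_pow]
    exact mul_le_of_le_one_right (abs_nonneg p) (pow_le_one₀ (abs_nonneg p) hp.le)
  have h2 := abs_sub_abs_le_abs_sub 1 (p * p ^ i)
  rw [abs_one] at h2
  linarith

theorem qShifted_self_ne_zero {p : ℝ} (hp : |p| < 1) (k : ℕ) : qShifted p p k ≠ 0 := fun h => by
  have h1 := le_abs_qShifted hp k
  have h2 : 0 < (1 - |p|) ^ k := pow_pos (by linarith) k
  rw [h, abs_zero] at h1
  linarith

theorem summable_pow_sq_mul_pow {r : ℝ} (hr0 : 0 ≤ r) (hr : r < 1) (x : ℝ) :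
    Summable fun k : ℕ => r ^ k ^ 2 * x ^ k := by
  rcases eq_or_ne r 0 with rfl | hr1
  · refine summable_of_ne_finset_zero (s := {0}) fun k hk => ?_
    have : k ^ 2 ≠ 0 := pow_ne_zero 2 (by simpa using hk)
    rw [zero_pow this, zero_mul]
  rcases eq_or_ne x 0 with rfl | hx
  · refine summable_of_ne_finset_zero (s := {0}) fun k hk => ?_
    rw [zero_pow (by simpa using hk), mul_zero]
  refine summable_of_ratio_test_tendsto_lt_one (l := 0) one_pos
    (Eventually.of_forall fun k => mul_ne_zero (pow_ne_zero _ hr1) (pow_ne_zero _ hx)) ?_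
  have h1 : ∀ k : ℕ, ‖r ^ (k + 1) ^ 2 * x ^ (k + 1)‖ / ‖r ^ k ^ 2 * x ^ k‖ =
      (r ^ 2) ^ k * (r * |x|) := fun k => by
    rw [← norm_div, Real.norm_eq_abs]
    have : r ^ (k + 1) ^ 2 * x ^ (k + 1) / (r ^ k ^ 2 * x ^ k) = (r ^ 2) ^ k * (r * x) := by
      rw [div_eq_iff (mul_ne_zero (pow_ne_zero _ hr1) (pow_ne_zero _ hx))]
      ring
    rw [this, abs_mul, abs_mul, abs_of_nonneg hr0, abs_of_nonneg (pow_nonneg (sq_nonneg r) k)]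
  simp only [h1]
  simpa using (tendsto_pow_atTop_nhds_zero_of_lt_one (sq_nonneg r)
    (by nlinarith)).mul_const (r * |x|)

/-- The general term of Cauchy's identity, multiplied by the infinite product. -/
noncomputable def cauchyTerm (p A : ℝ) (k : ℕ) : ℝ :=
  p ^ k ^ 2 * A ^ k / qShifted p p k * qShiftedInf (A * p ^ (k + 1)) p

theorem abs_cauchyTerm_le {p A C : ℝ} (hp : |p| < 1) (hA : |A| ≤ C) (k : ℕ) :
    |cauchyTerm p A k| ≤
      |p| ^ k ^ 2 * (C * (1 - |p|)⁻¹) ^ k * Real.exp (C * (1 - |p|)⁻¹) := by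
  have hp1 : 0 < 1 - |p| := by linarith
  have hC : 0 ≤ C := (abs_nonneg A).trans hA
  rw [cauchyTerm, abs_mul, abs_div, abs_mul, abs_pow, abs_pow, mul_pow, inv_pow, ← mul_assoc,
    ← div_eq_mul_inv (|p| ^ k ^ 2 * C ^ k)]
  have hAp : |A * p ^ (k + 1)| ≤ C := by
    rw [abs_mul, abs_pow]
    exact (mul_le_of_le_one_right (abs_nonneg A) (pow_le_one₀ (abs_nonneg p) hp.le)).trans hA
  refine mul_le_mul ?_ (abs_qShiftedInf_le hp hAp) (abs_nonneg _) (by positivity)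
  exact div_le_div₀ (by positivity)
    (mul_le_mul_of_nonneg_left (pow_le_pow_left₀ (abs_nonneg A) hA k) (by positivity))
    (pow_pos hp1 k) (le_abs_qShifted hp k)

theorem summable_cauchyTerm_bound {p : ℝ} (hp : |p| < 1) (C : ℝ) :
    Summable fun k : ℕ =>
      |p| ^ k ^ 2 * (C * (1 - |p|)⁻¹) ^ k * Real.exp (C * (1 - |p|)⁻¹) :=
  (summable_pow_sq_mul_pow (abs_nonneg p) hp _).mul_right _

theorem summable_cauchyTerm {p : ℝ} (hp : |p| < 1) (A : ℝ) : Summable (cauchyTerm p A) :=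
  Summable.of_norm_bounded (summable_cauchyTerm_bound hp |A|) fun k =>
    abs_cauchyTerm_le hp le_rfl k

theorem pow_mul_cauchyTerm {p : ℝ} (hp : |p| < 1) (A : ℝ) (k : ℕ) :
    p ^ k * cauchyTerm p A k = cauchyTerm p (A * p) k * (1 - A * p ^ (k + 1)) := by
  rw [cauchyTerm, cauchyTerm, qShiftedInf_eq_mul (A * p ^ (k + 1)) p hp]
  have : A * p * p ^ (k + 1) = A * p ^ (k + 1) * p := by ring
  rw [this]
  ring

theorem one_sub_pow_mul_cauchyTerm_succ {p : ℝ} (hp : |p| < 1) (A : ℝ) (k : ℕ) :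
    (1 - p ^ (k + 1)) * cauchyTerm p A (k + 1) = cauchyTerm p (A * p) k * (A * p ^ (k + 1)) := by
  have h1 := qShifted_self_ne_zero hp k
  have h2 := qShifted_self_ne_zero hp (k + 1)
  rw [qShifted_succ, ← pow_succ'] at h2
  have h3 := right_ne_zero_of_mul h2
  have : A * p * p ^ (k + 1) = A * p ^ (k + 1 + 1) := by ring
  rw [cauchyTerm, cauchyTerm, qShifted_succ, ← pow_succ' p k, this]
  field_simp
  ring

/-- Write `1 = p ^ k + (1 - p ^ k)` in each term and shift the index in the second part. The two
parts become the terms for `A * p` with factors `1 - A * p ^ (k + 1)` and `A * p ^ (k + 1)`, which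
add up to 1. -/
theorem tsum_cauchyTerm_mul {p : ℝ} (hp : |p| < 1) (A : ℝ) :
    ∑' k, cauchyTerm p A k = ∑' k, cauchyTerm p (A * p) k := by
  have hs := summable_cauchyTerm hp A
  have hs1 : Summable fun k => p ^ k * cauchyTerm p A k := by
    refine Summable.of_norm_bounded hs.norm fun k => ?_
    rw [norm_mul, norm_pow]
    exact mul_le_of_le_one_left (norm_nonneg _) (pow_le_one₀ (norm_nonneg p) hp.le)
  have hs2 : Summable fun k => (1 - p ^ k) * cauchyTerm p A k := by
    refine (hs.sub hs1).congr fun k => ?_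
    ring
  have h1 : ∑' k, cauchyTerm p A k =
      ∑' k, p ^ k * cauchyTerm p A k + ∑' k, (1 - p ^ k) * cauchyTerm p A k := by
    rw [← hs1.tsum_add hs2]
    exact tsum_congr fun k => by ring
  have hs3 : Summable fun k => (1 - p ^ (k + 1)) * cauchyTerm p A (k + 1) :=
    (summable_nat_add_iff 1).2 hs2
  rw [h1, hs2.tsum_eq_zero_add, pow_zero, sub_self, zero_mul, zero_add, ← hs1.tsum_add hs3]
  refine tsum_congr fun k => ?_
  rw [pow_mul_cauchyTerm hp, one_sub_pow_mul_cauchyTerm_succ hp]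
  ring

/-- Cauchy's identity. -/
theorem tsum_cauchyTerm {p : ℝ} (hp : |p| < 1) (A : ℝ) : ∑' k, cauchyTerm p A k = 1 := by
  -- The sum is unchanged under `A ↦ A * p`; iterating drives the parameter to 0, where only the
  -- term `k = 0` survives.
  have hconst : ∀ m : ℕ, ∑' k, cauchyTerm p (A * p ^ m) k = ∑' k, cauchyTerm p A k := by
    intro m
    induction m with
    | zero => simp
    | succ m ih => rw [← ih, tsum_cauchyTerm_mul hp (A * p ^ m), mul_assoc, ← pow_succ]
  have hA : Tendsto (fun m : ℕ => A * p ^ m) atTop (𝓝 0) := by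
    simpa using (tendsto_pow_atTop_nhds_zero_of_abs_lt_one hp).const_mul A
  have hlim : Tendsto (fun m : ℕ => ∑' k, cauchyTerm p (A * p ^ m) k) atTop
      (𝓝 (∑' k : ℕ, if k = 0 then (1 : ℝ) else 0)) := by
    refine tendsto_tsum_of_dominated_convergence (summable_cauchyTerm_bound hp |A|) (fun k => ?_)
      (Eventually.of_forall fun m k => abs_cauchyTerm_le hp ?_ k)
    · have h1 : Tendsto (fun m : ℕ => qShiftedInf (A * p ^ m * p ^ (k + 1)) p) atTop (𝓝 1) :=
        tendsto_qShiftedInf hp (by simpa using hA.mul_const (p ^ (k + 1)))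
      have h2 := (((hA.pow k).const_mul (p ^ k ^ 2)).div_const (qShifted p p k)).mul h1
      refine h2.congr' (Eventually.of_forall fun m => rfl) |>.trans_eq ?_
      rcases eq_or_ne k 0 with rfl | hk
      · simp [qShifted]
      · simp [hk]
    · rw [abs_mul, abs_pow]
      exact mul_le_of_le_one_right (abs_nonneg A) (pow_le_one₀ (abs_nonneg p) hp.le)
  simp only [hconst, tsum_ite_eq] at hlim
  exact tendsto_nhds_unique tendsto_const_nhds hlim

/-- Dividing the infinite product by its first `k` factors leaves its tail, so `cauchyTerm` is the
weight without the denominator that depends on `a`. -/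
theorem alSalamCarlitzWeight_eq_cauchyTerm {a p : ℝ} (hp : |p| < 1) {k : ℕ}
    (h : qShifted (a * p) p k ≠ 0) : alSalamCarlitzWeight a p k = cauchyTerm p a k := by
  rw [alSalamCarlitzWeight, cauchyTerm, qShiftedInf_eq_qShifted_mul (a * p) p hp k]
  have h2 := qShifted_self_ne_zero hp k
  have : a * p * p ^ k = a * p ^ (k + 1) := by ring
  rw [this]
  field_simp

theorem hasSum_alSalamCarlitzWeight {a p : ℝ} (hp : |p| < 1)
    (h : ∀ k, qShifted (a * p) p k ≠ 0) : HasSum (alSalamCarlitzWeight a p) 1 := by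
  have heq : alSalamCarlitzWeight a p = cauchyTerm p a :=
    funext fun k => alSalamCarlitzWeight_eq_cauchyTerm hp (h k)
  rw [heq, ← tsum_cauchyTerm hp a]
  exact (summable_cauchyTerm hp a).hasSum

theorem alSalamCarlitzWeight_succ {a p : ℝ} (hp : |p| < 1)
    {k : ℕ} (h : qShifted (a * p) p (k + 1) ≠ 0) :
    alSalamCarlitzWeight a p (k + 1) * ((1 - p ^ (k + 1)) * (1 - a * p ^ (k + 1))) =
      alSalamCarlitzWeight a p k * (p ^ (2 * k + 1) * a) := by
  have h2 := qShifted_self_ne_zero hp (k + 1)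
  have h3 : a * p * p ^ k = a * p ^ (k + 1) := by ring
  rw [qShifted_succ, ← pow_succ'] at h2
  rw [qShifted_succ, h3] at h
  have h4 := left_ne_zero_of_mul h
  have h5 := right_ne_zero_of_mul h
  have h6 := left_ne_zero_of_mul h2
  have h7 := right_ne_zero_of_mul h2
  rw [alSalamCarlitzWeight, alSalamCarlitzWeight, qShifted_succ, qShifted_succ, h3,
    ← pow_succ' p k]
  field_simp
  ring

end CauchyIdentity

/-! ### The recursion for the probabilities at fixed dimension. -/

section FixedProbability

/-- The probability that a random element of `U(n,q)` has exactly `q ^ (2 * k)` fixed vectors. -/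
noncomputable def fixedProb (q : ℕ) (F : Type*) [Field F] (n k : ℕ) : ℝ :=
  uniformMean fun g : finiteUnitaryGroup q F n =>
    if numFixedVectors g.1 = q ^ (2 * k) then (1 : ℝ) else 0

variable {q : ℕ} {F : Type*} [Field F]

theorem fixedProb_eq_meanFixed {σ : F →+* F} (hσ : ∀ x, σ x = x ^ q) (n k : ℕ) :
    fixedProb q F n k =
      meanFixed F (standardForm σ n) fun m => if m = q ^ (2 * k) then (1 : ℝ) else 0 :=
  uniformMean_finiteUnitaryGroup hσ n fun m => if m = q ^ (2 * k) then (1 : ℝ) else 0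

/-- The probability `fixedProb q F n (k - 1)`, with the value `0` for `k = 0`. -/
noncomputable def fixedProbPred (q : ℕ) (F : Type*) [Field F] (n k : ℕ) : ℝ :=
  if k = 0 then 0 else fixedProb q F n (k - 1)

theorem sq_mul_eq_pow_iff (hq : 0 < q) (m k : ℕ) :
    q ^ 2 * m = q ^ (2 * (k + 1)) ↔ m = q ^ (2 * k) := by
  rw [mul_add, mul_one, add_comm, pow_add]
  exact Nat.mul_right_inj (pow_pos hq 2).ne'

/-- At `k = 0` the condition would be `q ^ 4 * m = q ^ 2`, which is impossible; this is the reason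
for the value 0 in `fixedProbPred`. -/
theorem fixedProbPred_eq_meanFixed {σ : F →+* F} (hσ : ∀ x, σ x = x ^ q) (hq : 2 ≤ q) (n k : ℕ) :
    fixedProbPred q F n k = meanFixed F (standardForm σ n) fun m =>
      if q ^ 4 * m = q ^ (2 * (k + 1)) then (1 : ℝ) else 0 := by
  have h4 : ∀ m, q ^ 4 * m = q ^ 2 * (q ^ 2 * m) := fun m => by ring
  simp only [h4, sq_mul_eq_pow_iff (by omega : 0 < q)]
  rcases k with _ | k
  · have h0 : ∀ m, ¬(q ^ 2 * m = q ^ (2 * 0)) := fun m h => by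
      have h1 := Nat.eq_one_of_mul_eq_one_right h
      nlinarith
    simp only [h0]
    simp [fixedProbPred, meanFixed, uniformMean]
  · simp only [sq_mul_eq_pow_iff (by omega : 0 < q)]
    rw [fixedProbPred, if_neg (Nat.succ_ne_zero k), Nat.add_sub_cancel, fixedProb_eq_meanFixed hσ]

theorem fixedProb_nonneg (n k : ℕ) : 0 ≤ fixedProb q F n k :=
  uniformMean_nonneg fun _ => by split_ifs <;> norm_num

theorem meanFixed_add {V : Type*} [AddCommGroup V] [Module F V] [Finite V]
    {B : V → V → F}
    (f g : ℕ → ℝ) :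
    meanFixed F B (fun m => f m + g m) = meanFixed F B f + meanFixed F B g :=
  uniformMean_add _ _

theorem meanFixed_const_mul {V : Type*} [AddCommGroup V] [Module F V] [Finite V]
    {B : V → V → F}
    (c : ℝ) (f : ℕ → ℝ) : meanFixed F B (fun m => c * f m) = c * meanFixed F B f :=
  uniformMean_const_mul _ _

variable [Finite F]

theorem fixedProb_le_one (n k : ℕ) : fixedProb q F n k ≤ 1 := by
  have := Fintype.ofFinite (finiteUnitaryGroup q F n)
  rw [fixedProb, uniformMean_eq_sum, Nat.card_eq_fintype_card]
  refine div_le_one_of_le₀ ?_ (Nat.cast_nonneg _)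
  refine (Finset.sum_le_card_nsmul _ _ 1 fun g _ => ?_).trans (by simp)
  split_ifs <;> norm_num

theorem fixedProb_zero_succ (hq : 2 ≤ q) (k : ℕ) : fixedProb q F 0 (k + 1) = 0 := by
  have h : ∀ g : finiteUnitaryGroup q F 0, ¬(numFixedVectors g.1 = q ^ (2 * (k + 1))) := by
    intro g hg
    have h1 : numFixedVectors g.1 ≤ 1 := Finite.card_le_one_iff_subsingleton.2 inferInstance
    have h2 : 1 < q ^ (2 * (k + 1)) := Nat.one_lt_pow (by omega) (by omega)
    omega
  simp [fixedProb, h, uniformMean]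

theorem sub_one_mul_ite (k : ℕ) :
    (fun m : ℕ => ((m : ℝ) - 1) * if m = q ^ (2 * k) then (1 : ℝ) else 0) =
      fun m => ((q : ℝ) ^ (2 * k) - 1) * if m = q ^ (2 * k) then (1 : ℝ) else 0 := by
  funext m
  split_ifs with h
  · rw [h]; push_cast; ring
  · simp

theorem fixedProb_one_succ {σ : F →+* F} (hσ : ∀ x, σ x = x ^ q) (hσ' : IsQuadraticConj q σ)
    (k : ℕ) :
    ((q : ℝ) ^ (2 * (k + 1)) - 1) * fixedProb q F 1 (k + 1) = (q - 1) * fixedProb q F 0 k := by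
  have hq := hσ'.two_le
  have h := meanFixed_standardForm_one hσ' fun m => if m = q ^ (2 * (k + 1)) then (1 : ℝ) else 0
  simp only [sq_mul_eq_pow_iff (by omega : 0 < q)] at h
  rw [sub_one_mul_ite, meanFixed_const_mul, ← fixedProb_eq_meanFixed hσ,
    ← fixedProb_eq_meanFixed hσ] at h
  exact h

/-- Test the recursion on the indicator of `q ^ (2 * (k + 1))`: the arguments `m`, `q ^ 2 * m` and
`q ^ 4 * m` pick out the indices `k + 1`, `k` and `k - 1`. The last coefficient is `1 / (m * q)` at
`m = q ^ (2 * (k - 1))`, written without natural subtraction. -/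
theorem fixedProb_add_two_succ {σ : F →+* F} (hσ : ∀ x, σ x = x ^ q) (hσ' : IsQuadraticConj q σ)
    (n k : ℕ) :
    ((q : ℝ) ^ (2 * (k + 1)) - 1) * fixedProb q F (n + 2) (k + 1) =
      (q - 1) * fixedProb q F (n + 1) k +
        ((1 - 1 / (q : ℝ) ^ (2 * (k + 1))) * fixedProb q F n (k + 1) +
          (1 / (q : ℝ) ^ (2 * k) * (1 - 1 / q) * fixedProb q F n k +
            (q : ℝ) ^ 3 / (q : ℝ) ^ (2 * (k + 1)) * fixedProbPred q F n k)) := by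
  have hq := hσ'.two_le
  have hq0 : (q : ℝ) ≠ 0 := by exact_mod_cast (by omega : q ≠ 0)
  have h := meanFixed_standardForm_add_two hσ' n
    fun m => if m = q ^ (2 * (k + 1)) then (1 : ℝ) else 0
  have h3 : (fun m : ℕ => (1 - 1 / (m : ℝ)) * (if m = q ^ (2 * (k + 1)) then (1 : ℝ) else 0) +
      1 / (m : ℝ) * ((1 - 1 / (q : ℝ)) * (if q ^ 2 * m = q ^ (2 * (k + 1)) then (1 : ℝ) else 0) +
        1 / (q : ℝ) * if q ^ 4 * m = q ^ (2 * (k + 1)) then (1 : ℝ) else 0)) =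
      fun m => (1 - 1 / (q : ℝ) ^ (2 * (k + 1))) * (if m = q ^ (2 * (k + 1)) then (1 : ℝ) else 0) +
        (1 / (q : ℝ) ^ (2 * k) * (1 - 1 / q) * (if m = q ^ (2 * k) then (1 : ℝ) else 0) +
          (q : ℝ) ^ 3 / (q : ℝ) ^ (2 * (k + 1)) *
            if q ^ 4 * m = q ^ (2 * (k + 1)) then (1 : ℝ) else 0) := by
    funext m
    simp only [sq_mul_eq_pow_iff (by omega : 0 < q)]
    have t1 : (1 - 1 / (m : ℝ)) * (if m = q ^ (2 * (k + 1)) then (1 : ℝ) else 0) =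
        (1 - 1 / (q : ℝ) ^ (2 * (k + 1))) * (if m = q ^ (2 * (k + 1)) then (1 : ℝ) else 0) := by
      split_ifs with h1
      · rw [h1]; push_cast; ring
      · simp
    have t2 : 1 / (m : ℝ) * ((1 - 1 / (q : ℝ)) * (if m = q ^ (2 * k) then (1 : ℝ) else 0)) =
        1 / (q : ℝ) ^ (2 * k) * (1 - 1 / q) * (if m = q ^ (2 * k) then (1 : ℝ) else 0) := by
      split_ifs with h1
      · rw [h1]; push_cast; ring
      · simp
    have t3 : 1 / (m : ℝ) *
        (1 / (q : ℝ) * (if q ^ 4 * m = q ^ (2 * (k + 1)) then (1 : ℝ) else 0)) =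
        (q : ℝ) ^ 3 / (q : ℝ) ^ (2 * (k + 1)) *
          if q ^ 4 * m = q ^ (2 * (k + 1)) then (1 : ℝ) else 0 := by
      split_ifs with h1
      · have h2 : (q : ℝ) ^ (2 * (k + 1)) = (q : ℝ) ^ 4 * m := by exact_mod_cast h1.symm
        have hm : (m : ℝ) ≠ 0 := fun h0 => by
          rw [h0, mul_zero] at h2
          exact pow_ne_zero _ hq0 h2
        rw [h2]
        field_simp
      · simp
    rw [← t1, ← t2, ← t3]
    ring
  rw [h3, meanFixed_add, meanFixed_add, meanFixed_const_mul, meanFixed_const_mul,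
    meanFixed_const_mul, sub_one_mul_ite, meanFixed_const_mul] at h
  simp only [sq_mul_eq_pow_iff (by omega : 0 < q)] at h
  rw [← fixedProbPred_eq_meanFixed hσ hq, ← fixedProb_eq_meanFixed hσ, ← fixedProb_eq_meanFixed hσ,
    ← fixedProb_eq_meanFixed hσ, ← fixedProb_eq_meanFixed hσ] at h
  exact h

end FixedProbability

/-! ### Averaging over the dimension. -/

section GeometricMean

/-- The mean of a sequence with respect to the geometric distribution. -/
noncomputable def geometricMean (a : ℝ) (φ : ℕ → ℝ) : ℝ :=
  ∑' n, (1 - a) * a ^ n * φ n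

variable {a : ℝ}

theorem summable_geometricMean (ha0 : 0 ≤ a) (ha1 : a < 1) {φ : ℕ → ℝ} (h0 : ∀ n, 0 ≤ φ n)
    (h1 : ∀ n, φ n ≤ 1) : Summable fun n => (1 - a) * a ^ n * φ n := by
  have h2 : ∀ n : ℕ, 0 ≤ (1 - a) * a ^ n := fun n =>
    mul_nonneg (by linarith) (pow_nonneg ha0 n)
  exact Summable.of_nonneg_of_le (fun n => mul_nonneg (h2 n) (h0 n))
    (fun n => mul_le_of_le_one_right (h2 n) (h1 n))
    ((summable_geometric_of_lt_one ha0 ha1).mul_left (1 - a))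

theorem geometricMean_eq_zero_add {φ : ℕ → ℝ} (h : Summable fun n => (1 - a) * a ^ n * φ n) :
    geometricMean a φ = (1 - a) * φ 0 + a * geometricMean a fun n => φ (n + 1) := by
  rw [geometricMean, h.tsum_eq_zero_add, geometricMean, ← tsum_mul_left, pow_zero, mul_one]
  congr 1
  exact tsum_congr fun n => by ring

theorem geometricMean_add {φ ψ : ℕ → ℝ} (hφ : Summable fun n => (1 - a) * a ^ n * φ n)
    (hψ : Summable fun n => (1 - a) * a ^ n * ψ n) :
    geometricMean a (fun n => φ n + ψ n) = geometricMean a φ + geometricMean a ψ := by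
  rw [geometricMean, geometricMean, geometricMean, ← hφ.tsum_add hψ]
  exact tsum_congr fun n => by ring

theorem summable_geometricMean_const_mul (c : ℝ) {φ : ℕ → ℝ}
    (h : Summable fun n => (1 - a) * a ^ n * φ n) :
    Summable fun n => (1 - a) * a ^ n * (c * φ n) :=
  (h.mul_left c).congr fun n => by ring

theorem summable_geometricMean_add {φ ψ : ℕ → ℝ} (hφ : Summable fun n => (1 - a) * a ^ n * φ n)
    (hψ : Summable fun n => (1 - a) * a ^ n * ψ n) :
    Summable fun n => (1 - a) * a ^ n * (φ n + ψ n) :=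
  (hφ.add hψ).congr fun n => by ring

theorem geometricMean_const_mul (c : ℝ) (φ : ℕ → ℝ) :
    geometricMean a (fun n => c * φ n) = c * geometricMean a φ := by
  rw [geometricMean, geometricMean, ← tsum_mul_left]
  exact tsum_congr fun n => by ring

end GeometricMean

section MixedProbability

variable {q : ℕ} {F : Type*} [Field F] [Finite F] {a : ℝ}

theorem summable_fixedProb (ha0 : 0 ≤ a) (ha1 : a < 1) (i k : ℕ) :
    Summable fun n => (1 - a) * a ^ n * fixedProb q F (n + i) k :=
  summable_geometricMean ha0 ha1 (fun _ => fixedProb_nonneg _ _) fun _ => fixedProb_le_one _ _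

theorem summable_fixedProbPred (ha0 : 0 ≤ a) (ha1 : a < 1) (k : ℕ) :
    Summable fun n => (1 - a) * a ^ n * fixedProbPred q F n k := by
  rcases k with _ | k
  · simp [fixedProbPred, summable_zero]
  · simpa [fixedProbPred] using summable_fixedProb (q := q) (F := F) ha0 ha1 0 k

/-- The recursion for the probabilities in a random unitary group. -/
theorem geometricMean_fixedProb_succ {σ : F →+* F} (hσ : ∀ x, σ x = x ^ q)
    (hσ' : IsQuadraticConj q σ) (ha0 : 0 ≤ a) (ha1 : a < 1) (k : ℕ) :
    ((q : ℝ) ^ (2 * (k + 1)) - 1) * geometricMean a (fun n => fixedProb q F n (k + 1)) =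
      (q - 1) * a * geometricMean a (fun n => fixedProb q F n k) +
        a ^ 2 * ((1 - 1 / (q : ℝ) ^ (2 * (k + 1))) *
            geometricMean a (fun n => fixedProb q F n (k + 1)) +
          (1 / (q : ℝ) ^ (2 * k) * (1 - 1 / q) * geometricMean a (fun n => fixedProb q F n k) +
            (q : ℝ) ^ 3 / (q : ℝ) ^ (2 * (k + 1)) *
              geometricMean a (fun n => fixedProbPred q F n k))) := by
  have hs := summable_fixedProb (q := q) (F := F) ha0 ha1
  have hs0 : ∀ k, Summable fun n => (1 - a) * a ^ n * fixedProb q F n k := hs 0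
  have e1 := geometricMean_eq_zero_add (hs0 (k + 1))
  have e2 := geometricMean_eq_zero_add (hs 1 (k + 1))
  have e3 := geometricMean_eq_zero_add (hs0 k)
  have e4 : ((q : ℝ) ^ (2 * (k + 1)) - 1) * geometricMean a (fun n => fixedProb q F (n + 2) (k + 1)) =
      (q - 1) * geometricMean a (fun n => fixedProb q F (n + 1) k) +
        ((1 - 1 / (q : ℝ) ^ (2 * (k + 1))) * geometricMean a (fun n => fixedProb q F n (k + 1)) +
          (1 / (q : ℝ) ^ (2 * k) * (1 - 1 / q) * geometricMean a (fun n => fixedProb q F n k) +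
            (q : ℝ) ^ 3 / (q : ℝ) ^ (2 * (k + 1)) *
              geometricMean a (fun n => fixedProbPred q F n k))) := by
    rw [← geometricMean_const_mul]
    simp only [fixedProb_add_two_succ hσ hσ']
    have s2 := summable_geometricMean_const_mul (1 - 1 / (q : ℝ) ^ (2 * (k + 1))) (hs0 (k + 1))
    have s3 := summable_geometricMean_const_mul (1 / (q : ℝ) ^ (2 * k) * (1 - 1 / q)) (hs0 k)
    have s4 := summable_geometricMean_const_mul ((q : ℝ) ^ 3 / (q : ℝ) ^ (2 * (k + 1)))
      (summable_fixedProbPred (q := q) (F := F) ha0 ha1 k)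
    rw [geometricMean_add (summable_geometricMean_const_mul _ (hs 1 k))
        (summable_geometricMean_add s2 (summable_geometricMean_add s3 s4)),
      geometricMean_add s2 (summable_geometricMean_add s3 s4), geometricMean_add s3 s4,
      geometricMean_const_mul, geometricMean_const_mul, geometricMean_const_mul,
      geometricMean_const_mul]
  have e5 := fixedProb_one_succ hσ hσ' k
  have e6 := fixedProb_zero_succ (F := F) hσ'.two_le k
  simp only [zero_add, add_assoc, Nat.reduceAdd] at e1 e2 e3
  rw [e6, mul_zero, zero_add] at e1
  -- The boundary term of dimension 0 in `e1` vanishes by `e6`, and that of dimension 1 in `e2`,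
  -- evaluated by `e5`, cancels the boundary term of `e3`.
  linear_combination ((q : ℝ) ^ (2 * (k + 1)) - 1) * e1 +
    ((q : ℝ) ^ (2 * (k + 1)) - 1) * a * e2 + (1 - a) * a * e5 + a ^ 2 * e4 - (q - 1) * a * e3

end MixedProbability

/-! ### The law of the number of fixed vectors as a geometric mean. -/

section Law

variable {q : ℕ} {F : Type*} [Field F] {a : ℝ}

theorem exists_numFixedVectors_eq (hF : Nat.card F = q ^ 2) {n : ℕ}
    (g : Matrix.GeneralLinearGroup (Fin n) F) : ∃ k, numFixedVectors g = q ^ (2 * k) := by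
  let K : Submodule F (Fin n → F) :=
    LinearMap.ker ((g : Matrix (Fin n) (Fin n) F).mulVecLin - LinearMap.id)
  have h : numFixedVectors g = Nat.card K :=
    Nat.card_congr (Equiv.subtypeEquivRight fun v => by simp [K, sub_eq_zero])
  exact ⟨Module.finrank F K, by rw [h, Module.natCard_eq_pow_finrank (K := F), hF, pow_mul]⟩

variable [Finite F]

theorem map_uniformUnitary_apply (n k : ℕ) :
    ((uniformUnitary q F n).map fun g => numFixedVectors g.1) (q ^ (2 * k)) =
      ENNReal.ofReal (fixedProb q F n k) := by
  classical
  let _ : Fintype (finiteUnitaryGroup q F n) := Fintype.ofFinite _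
  have hu : ∀ g, uniformUnitary q F n g =
      ENNReal.ofReal (Nat.card (finiteUnitaryGroup q F n) : ℝ)⁻¹ := by
    intro g
    rw [uniformUnitary, PMF.uniformOfFintype_apply, ENNReal.ofReal_inv_of_pos,
      ENNReal.ofReal_natCast, Nat.card_eq_fintype_card]
    · exact_mod_cast Nat.card_pos
  rw [PMF.map_apply, tsum_fintype, fixedProb, uniformMean_eq_sum, Finset.sum_div,
    ENNReal.ofReal_sum_of_nonneg]
  · refine Finset.sum_congr rfl fun g _ => ?_
    rw [hu]
    by_cases h : numFixedVectors g.1 = q ^ (2 * k)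
    · rw [if_pos h.symm, if_pos h, one_div]
    · rw [if_neg (Ne.symm h), if_neg h, zero_div, ENNReal.ofReal_zero]
  · intro g _
    split_ifs <;> positivity

theorem fixedVectorsLaw_apply (ha0 : 0 ≤ a) (ha1 : a < 1) (k : ℕ) :
    (fixedVectorsLaw q F a ha0 ha1 (q ^ (2 * k))).toReal =
      geometricMean a fun n => fixedProb q F n k := by
  have h0 : ∀ n : ℕ, 0 ≤ (1 - a) * a ^ n := fun n =>
    mul_nonneg (by linarith) (pow_nonneg ha0 n)
  have h1 : fixedVectorsLaw q F a ha0 ha1 = (geometricSizeLaw a ha0 ha1).bind fun n =>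
      (uniformUnitary q F n).map fun g => numFixedVectors g.1 := by
    rw [fixedVectorsLaw, randomUnitary, PMF.map_bind]
    refine congrArg _ (funext fun n => ?_)
    rw [PMF.map_comp]
    rfl
  have h2 : ∀ n, geometricSizeLaw a ha0 ha1 n = ENNReal.ofReal ((1 - a) * a ^ n) := fun _ => rfl
  rw [h1, PMF.bind_apply]
  simp only [map_uniformUnitary_apply, h2, ← ENNReal.ofReal_mul (h0 _)]
  rw [ENNReal.tsum_toReal_eq fun _ => ENNReal.ofReal_ne_top, geometricMean]
  exact tsum_congr fun n => ENNReal.toReal_ofReal (mul_nonneg (h0 n) (fixedProb_nonneg _ _))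

/-- The number of fixed vectors is a power of `q ^ 2`. -/
theorem hasSum_fixedVectorsLaw (hq : 2 ≤ q) (hF : Nat.card F = q ^ 2) (ha0 : 0 ≤ a) (ha1 : a < 1) :
    HasSum (fun k => (fixedVectorsLaw q F a ha0 ha1 (q ^ (2 * k))).toReal) 1 := by
  have hinj : Function.Injective fun k : ℕ => q ^ (2 * k) := fun i j hij => by
    have := Nat.pow_right_injective hq hij
    omega
  have hsupp : Function.support (fixedVectorsLaw q F a ha0 ha1) ⊆
      Set.range fun k : ℕ => q ^ (2 * k) := by
    intro m hm
    have hm' : m ∈ (fixedVectorsLaw q F a ha0 ha1).support := hm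
    rw [fixedVectorsLaw, PMF.mem_support_map_iff] at hm'
    obtain ⟨g, _, rfl⟩ := hm'
    obtain ⟨k, hk⟩ := exists_numFixedVectors_eq hF g.2.1
    exact ⟨k, hk.symm⟩
  have hsum : ∑' k : ℕ, fixedVectorsLaw q F a ha0 ha1 (q ^ (2 * k)) = 1 := by
    rw [← (fixedVectorsLaw q F a ha0 ha1).tsum_coe]
    exact hinj.tsum_eq hsupp
  have h := ENNReal.hasSum_toReal (f := fun k : ℕ => fixedVectorsLaw q F a ha0 ha1 (q ^ (2 * k)))
    (by rw [hsum]; exact ENNReal.one_ne_top)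
  rwa [← ENNReal.tsum_toReal_eq fun _ => PMF.apply_ne_top _ _, hsum, ENNReal.toReal_one] at h

end Law

/-! ### The two-term recursion and the comparison with the weights. -/

theorem abs_neg_one_div_lt_one {q : ℕ} (hq : 2 ≤ q) : |-1 / (q : ℝ)| < 1 := by
  have h : (2 : ℝ) ≤ q := by exact_mod_cast hq
  rw [abs_div, abs_neg, abs_one, Nat.abs_cast, div_lt_one (by linarith)]
  linarith

theorem one_sub_neg_mul_pow_pos {a p : ℝ} (ha0 : 0 ≤ a) (ha1 : a < 1) (hp : |p| < 1) (k : ℕ) :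
    0 < 1 - -a * p ^ k := by
  have h1 : |p ^ k| ≤ 1 := by
    rw [abs_pow]; exact pow_le_one₀ (abs_nonneg p) hp.le
  have h2 : |a * p ^ k| < 1 := by
    rw [abs_mul, abs_of_nonneg ha0]
    exact (mul_le_of_le_one_right ha0 h1).trans_lt ha1
  have := (abs_lt.1 h2).1
  linarith

theorem qShifted_neg_mul_ne_zero {a p : ℝ} (ha0 : 0 ≤ a) (ha1 : a < 1) (hp : |p| < 1) (k : ℕ) :
    qShifted (-a * p) p k ≠ 0 :=
  Finset.prod_ne_zero_iff.2 fun i _ => by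
    have := one_sub_neg_mul_pow_pos ha0 ha1 hp (i + 1)
    rw [mul_assoc, ← pow_succ']
    exact this.ne'

/-- One step from the three-term recursion to a two-term recursion. -/
theorem two_term_of_three_term {p z a x y w : ℝ} (hp0 : p ≠ 0) (hz0 : z ≠ 0)
    (h1 : 1 + p * z ≠ 0) (h2 : 1 - a * (p * z) ≠ 0)
    (hrec : (1 / (p * z) ^ 2 - 1) * x = (-1 / p - 1) * a * y +
      a ^ 2 * ((1 - (p * z) ^ 2) * x + (z ^ 2 * (1 + p) * y + -(1 / p ^ 3) * (p * z) ^ 2 * w)))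
    (hprev : y * ((1 - z) * (1 - -a * z)) = w * (z ^ 2 / p * -a)) :
    x * ((1 - p * z) * (1 - -a * (p * z))) = y * (p * z ^ 2 * -a) := by
  have h3 : (1 - (p * z) ^ 2) * x = (p * z) ^ 2 * ((-1 / p - 1) * a * y +
      a ^ 2 * ((1 - (p * z) ^ 2) * x + (z ^ 2 * (1 + p) * y + -(1 / p ^ 3) * (p * z) ^ 2 * w))) := by
    rw [← hrec]; field_simp
  -- With `P = p * z`, the coefficient of `x` collects to `(1 - P ^ 2) * (1 - a ^ 2 * P ^ 2)`. After
  -- `hprev` eliminates `w`, the factor `(1 + P) * (1 - a * P)` is common to both sides.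
  refine mul_left_cancel₀ (mul_ne_zero h1 h2) ?_
  field_simp at h3 hprev
  linear_combination h3 - a * p * z ^ 2 * hprev

/-- Induction on `k`: the two-term relation one index lower eliminates the `fixedProbPred` term from
the averaged recursion, rewritten through `q ^ (2 * j) = 1 / (p ^ j) ^ 2`. -/
theorem geometricMean_fixedProb_ratio {q : ℕ} {F : Type*} [Field F] [Finite F] {σ : F →+* F}
    (hσ : ∀ x, σ x = x ^ q) (hσ' : IsQuadraticConj q σ) {a : ℝ} (ha0 : 0 ≤ a) (ha1 : a < 1)
    {p : ℝ} (hp : p = -1 / (q : ℝ)) (k : ℕ) :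
    geometricMean a (fun n => fixedProb q F n (k + 1)) *
        ((1 - p ^ (k + 1)) * (1 - -a * p ^ (k + 1))) =
      geometricMean a (fun n => fixedProb q F n k) * (p ^ (2 * k + 1) * -a) := by
  have hq := hσ'.two_le
  have hp1 : |p| < 1 := hp ▸ abs_neg_one_div_lt_one hq
  have hq0 : (q : ℝ) ≠ 0 := by exact_mod_cast (by omega : q ≠ 0)
  have hp0 : p ≠ 0 := by rw [hp]; exact div_ne_zero (by norm_num) hq0
  have hqp : (q : ℝ) = -1 / p := by rw [hp]; field_simp
  have hpow : ∀ j : ℕ, (q : ℝ) ^ (2 * j) = 1 / (p ^ j) ^ 2 := fun j => by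
    rw [hqp, ← pow_mul, mul_comm j 2, div_pow, pow_mul (-1 : ℝ), neg_one_sq, one_pow]
  have hlt : ∀ j : ℕ, |p ^ (j + 1)| < 1 := fun j => by
    rw [abs_pow]; exact pow_lt_one₀ (abs_nonneg p) hp1 (Nat.succ_ne_zero j)
  have step : ∀ k, geometricMean a (fun n => fixedProb q F n k) *
      ((1 - p ^ k) * (1 - -a * p ^ k)) =
        geometricMean a (fun n => fixedProbPred q F n k) * ((p ^ k) ^ 2 / p * -a) →
      geometricMean a (fun n => fixedProb q F n (k + 1)) *
        ((1 - p ^ (k + 1)) * (1 - -a * p ^ (k + 1))) =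
      geometricMean a (fun n => fixedProb q F n k) * (p ^ (2 * k + 1) * -a) := by
    intro k hprev
    have h1 : 1 + p * p ^ k ≠ 0 := by
      have := (abs_lt.1 (hlt k)).1
      rw [pow_succ'] at this
      linarith
    have h2 : 1 - a * (p * p ^ k) ≠ 0 := by
      have h3 : |a * (p * p ^ k)| < 1 := by
        rw [← pow_succ', abs_mul, abs_of_nonneg ha0]
        exact (mul_le_of_le_one_right ha0 (hlt k).le).trans_lt ha1
      have := (abs_lt.1 h3).2
      linarith
    have hrec := geometricMean_fixedProb_succ hσ hσ' ha0 ha1 k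
    rw [hpow, hpow, hqp, pow_succ' p k] at hrec
    have h := two_term_of_three_term hp0 (pow_ne_zero k hp0) h1 h2 (hrec.trans ?_) hprev
    · rw [pow_succ', h]
      ring
    · field_simp
      ring
  induction k with
  -- The relation below index 0 reads `0 = 0`: the left side has the factor `1 - p ^ 0`, and
  -- `fixedProbPred` vanishes at 0.
  | zero => exact step 0 (by simp [fixedProbPred, geometricMean])
  | succ k ih =>
    refine step (k + 1) (ih.trans ?_)
    have h1 : (p ^ (k + 1)) ^ 2 / p = p ^ (2 * k + 1) := by
      rw [div_eq_iff hp0]; ring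
    rw [h1]
    simp [fixedProbPred]

theorem mainTheorem8 (q : ℕ) (hq : IsPrimePow q) (F : Type*) [Field F] [Finite F]
    (hF : Nat.card F = q ^ 2) (a : ℝ) (ha0 : 0 ≤ a) (ha1 : a < 1) :
    (∀ k : ℕ, (fixedVectorsLaw q F a ha0 ha1 (q ^ (2 * k))).toReal =
        alSalamCarlitzWeight (-a) (-1 / (q : ℝ)) k) ∧
      (∀ k : ℕ, 0 ≤ alSalamCarlitzWeight (-a) (-1 / (q : ℝ)) k) ∧
      HasSum (fun k : ℕ => alSalamCarlitzWeight (-a) (-1 / (q : ℝ)) k) 1 := by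
  obtain ⟨σ, hσ, hσ'⟩ := exists_isQuadraticConj hq hF
  set p : ℝ := -1 / (q : ℝ) with hp
  have hp1 : |p| < 1 := abs_neg_one_div_lt_one hσ'.two_le
  set Φ : ℕ → ℝ := fun k => (fixedVectorsLaw q F a ha0 ha1 (q ^ (2 * k))).toReal with hΦ
  set w : ℕ → ℝ := alSalamCarlitzWeight (-a) p with hw
  have hΦsum : HasSum Φ 1 := hasSum_fixedVectorsLaw hσ'.two_le hF ha0 ha1
  have hwsum : HasSum w 1 :=
    hasSum_alSalamCarlitzWeight hp1 (qShifted_neg_mul_ne_zero ha0 ha1 hp1)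
  have hsucc : ∀ k, w (k + 1) * ((1 - p ^ (k + 1)) * (1 - -a * p ^ (k + 1))) =
      w k * (p ^ (2 * k + 1) * -a) := fun k =>
    alSalamCarlitzWeight_succ hp1 (qShifted_neg_mul_ne_zero ha0 ha1 hp1 (k + 1))
  have hne : ∀ k, (1 - p ^ (k + 1)) * (1 - -a * p ^ (k + 1)) ≠ 0 := fun k => by
    have h := (abs_lt.1 ((abs_pow p (k + 1)).trans_lt
      (pow_lt_one₀ (abs_nonneg p) hp1 (Nat.succ_ne_zero k)))).2
    exact mul_ne_zero (by linarith) (one_sub_neg_mul_pow_pos ha0 ha1 hp1 (k + 1)).ne'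
  -- Equal ratios make the two sequences proportional; the cross-multiplied form avoids dividing by
  -- `w 0` or `Φ 0`.
  have hprop : ∀ k, Φ k * w 0 = Φ 0 * w k := by
    intro k
    induction k with
    | zero => rfl
    | succ k ih =>
      have h1 : Φ (k + 1) * ((1 - p ^ (k + 1)) * (1 - -a * p ^ (k + 1))) =
          Φ k * (p ^ (2 * k + 1) * -a) := by
        simp only [hΦ, fixedVectorsLaw_apply]
        exact geometricMean_fixedProb_ratio hσ hσ' ha0 ha1 hp k
      refine mul_right_cancel₀ (hne k) ?_
      linear_combination w 0 * h1 + (p ^ (2 * k + 1) * -a) * ih - Φ 0 * hsucc k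
  -- Sum the proportionality over `k`; both totals are 1.
  have h0 : w 0 = Φ 0 := by
    have h1 : HasSum (fun k => Φ k * w 0) (1 * w 0) := hΦsum.mul_right _
    have h2 : HasSum (fun k => Φ 0 * w k) (Φ 0 * 1) := hwsum.mul_left _
    simp only [hprop] at h1
    simpa using h1.unique h2
  have hw0 : w 0 ≠ 0 := by
    intro hz
    have hall : ∀ k, w k = 0 := fun k => by
      induction k with
      | zero => exact hz
      | succ k ih =>
        have h := hsucc k
        rw [ih, zero_mul] at h
        exact (mul_eq_zero.1 h).resolve_right (hne k)
    rw [funext hall] at hwsum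
    exact zero_ne_one (hasSum_zero.unique hwsum)
  have heq : ∀ k, Φ k = w k := fun k =>
    mul_right_cancel₀ hw0 (by rw [hprop, h0, mul_comm])
  -- Nonnegativity of the weights is inherited from the probabilities, so the signs of the powers of
  -- `p` need no discussion.
  exact ⟨heq, fun k => heq k ▸ ENNReal.toReal_nonneg, hwsum⟩
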